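/- Let $c>0$, $\lambda>0$, let $V$ be a random variable with $P(V=c)=P(V=-c)=\tfrac12$, and let $N=(N(t))_{t\ge0}$ be a homogeneous Poisson process with rate $\lambda$, independent of $V$. Let $$\mathcal T(t)=\int_0^t V\,(-1)^{N(s)}\,ds,\qquad t\ge 0,$$ be the symmetric telegraph process with initial velocity $V(0)=V$. Then for every $t>0$ and every integer $k\ge0$, conditionally on $\{V(0)=c,\ N(t)=2k+1\}$, the maximum $\max_{0\le s\le t}\mathcal T(s)$ is absolutely continuous, with law $$P\Bigl\{\max_{0\le s\le t}\mathcal T(s)\in d\beta\ \Big|\ V(0)=c,\,N(t)=2k+1\Bigr\}=2\,\frac{(2k+1)!}{(k!)^2}\,\frac{(c^2t^2-\beta^2)^k}{(2ct)^{2k+1}}\,d\beta,\qquad 0<\beta<ct$$ (and no mass outside $(0,ct)$). On $(0,ct)$ this is twice the conditional density of $\mathcal T(t)$, since $$P\{\mathcal T(t)\in dx\mid V(0)=c,\,N(t)=2k+1\}=\frac{(2k+1)!}{(k!)^2}\,\frac{(c^2t^2-x^2)^k}{(2ct)^{2k+1}}\,dx,\qquad |x|<ct$$ (and no mass outside $(-ct,ct)$).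 Moreover, the following conditional reflection principle holds: for $0<\beta<ct$, \begin{align*} &P\Bigl\{\max_{0\le s\le t}\mathcal T(s)>\beta,\ \mathcal T(t)<\beta\ \Big|\ V(0)=c,\,N(t)=2k+1\Bigr\}\\ &\quad=P\Bigl\{\max_{0\le s\le t}\mathcal T(s)>\beta,\ \mathcal T(t)>\beta\ \Big|\ V(0)=c,\,N(t)=2k+1\Bigr\}\\ &\quad=P\{\mathcal T(t)>\beta\mid V(0)=c,\,N(t)=2k+1\}. \end{align*} -/

import Mathlib

open MeasureTheory ProbabilityTheory Set
open scoped NNReal ENNReal Nat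

namespace Telegraph


/-- `N` is a homogeneous Poisson process with the given rate on `(Ω, P)`: a counting process that
starts at `0`, has nondecreasing right-continuous paths (almost surely), has independent
increments, and for `s ≤ t` has the increment `N t - N s` (a difference of integers) distributed
as a Poisson variable with parameter `rate * (t - s)`. -/
structure IsPoissonProcess {Ω : Type*} [MeasurableSpace Ω] (rate : ℝ≥0) (N : ℝ≥0 → Ω → ℕ) (P : Measure Ω) : Prop where
  measurable : ∀ t, Measurable (N t)
  zero : ∀ᵐ ω ∂P, N 0 ω = 0
  path : ∀ᵐ ω ∂P, Monotone (fun t => N t ω) ∧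
    ∀ t, ContinuousWithinAt (fun s => N s ω) (Ici t) t
  indep : HasIndepIncrements (fun t ω => (N t ω : ℤ)) P
  law : ∀ s t, s ≤ t → HasLaw (fun ω => (N t ω : ℤ) - (N s ω : ℤ))
    ((poissonMeasure (rate * (t - s))).map (fun n : ℕ => (n : ℤ))) P

/-- The random inputs of a symmetric telegraph process with speed `c` and reversal rate `rate`:
a symmetric initial velocity `V` with values `c` and `-c`, and a Poisson process `N` counting the
reversals, independent (as a whole process) of `V`. -/
structure IsSymmetricTelegraph {Ω : Type*} [MeasurableSpace Ω] (rate : ℝ≥0) (c : ℝ) (V : Ω → ℝ) (N : ℝ≥0 → Ω → ℕ)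
    (P : Measure Ω) : Prop where
  measurable_velocity : Measurable V
  velocity_pos : P {ω | V ω = c} = 2⁻¹
  velocity_neg : P {ω | V ω = -c} = 2⁻¹
  poisson : IsPoissonProcess rate N P
  indep : IndepFun V (fun ω t => N t ω) P

/-- The position at time `t`: the integral over `[0, t]` of `V (-1) ^ N s`. -/
noncomputable def position {Ω : Type*} (V : Ω → ℝ) (N : ℝ≥0 → Ω → ℕ) (t : ℝ≥0) (ω : Ω) : ℝ :=
  ∫ s in (0 : ℝ)..(t : ℝ), V ω * (-1) ^ N s.toNNReal ω

/-- The maximum of the position over the times `0 ≤ s ≤ t` (attained on every nondecreasing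
counting path, see `isGreatest_maximum`). -/
noncomputable def maximum {Ω : Type*} (V : Ω → ℝ) (N : ℝ≥0 → Ω → ℕ) (t : ℝ≥0) (ω : Ω) : ℝ :=
  sSup ((fun s => position V N s ω) '' Icc 0 t)

theorem isGreatest_maximum {Ω : Type*} (V : Ω → ℝ) (N : ℝ≥0 → Ω → ℕ) (t : ℝ≥0) (ω : Ω)
    (h : Monotone (fun s => N s ω)) :
    IsGreatest ((fun s => position V N s ω) '' Icc 0 t) (maximum V N t ω) := by
  have hm : Measurable (fun s : ℝ => V ω * (-1) ^ N s.toNNReal ω) := by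
    have h1 : Measurable (fun s : ℝ => N s.toNNReal ω) :=
      Monotone.measurable (fun _ _ hab => h (Real.toNNReal_mono hab))
    exact (measurable_from_top (f := fun n : ℕ => V ω * (-1) ^ n)).comp h1
  have hi : ∀ a b : ℝ, IntervalIntegrable
      (fun s : ℝ => V ω * (-1) ^ N s.toNNReal ω) volume a b := by
    intro a b
    refine (intervalIntegrable_const (c := |V ω|)).mono_fun hm.aestronglyMeasurable ?_
    refine Filter.Eventually.of_forall fun s => ?_
    simp
  have hc : Continuous (fun s : ℝ≥0 => position V N s ω) :=
    (intervalIntegral.continuous_primitive hi 0).comp NNReal.continuous_coe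
  exact (isCompact_Icc.image hc).isGreatest_sSup ((nonempty_Icc.2 (zero_le)).image _)

/-- The function `(2k+1)! / (k!)² · (c²t² - x²)ᵏ / (2ct)²ᵏ⁺¹`. -/
noncomputable def density (c t : ℝ) (k : ℕ) (x : ℝ) : ℝ :=
  ((2 * k + 1)! : ℝ) / (k ! : ℝ) ^ 2 * ((c ^ 2 * t ^ 2 - x ^ 2) ^ k / (2 * c * t) ^ (2 * k + 1))

end Telegraph

/-!
The theorem is a statement about uniform points. Given `V = c` and `N t = m`, the reversal times are
distributed as `m` independent uniform points of `(0, t)`. Only a weak form of this is needed: for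
every regular grid of `[0, t]`, the increments of `N` over its cells have the same multinomial law
as the numbers of uniform points in the cells (`IsSymmetricTelegraph.identDistrib_cellIncrement`).
The position and the maximum are limits of functions of these increments, because the position
depends on the path of signs through an integral, uniformly in time; so their joint law can be
computed with uniform points (`IsSymmetricTelegraph.identDistrib_position_maximum`).

For the endpoint, splitting off the largest point gives a recursion on the number of points. In
terms of the time spent moving against the final direction it replaces `x` by `s - x`, where `s` is
the last reversal time, and sends the weight `x ^ a / a! * (t - x) ^ b / b!` to the same weight with
`(a, b)` replaced by `(b, a + 1)`. With `2 * k + 1` points the weight is that of `(k, k)`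
(`lintegral_oppositeTime_odd`), which is the stated density.

The reflection principle comes from a volume-preserving involution. Let `τ` be the first passage
time over the level, and reflect the points after `τ` in the interval `(τ, t)`, that is, replace `r`
by `t + τ - r`. The path before `τ` is unchanged, so `τ` is too. There is an even number of points
before `τ` since the path moves upwards there, hence an odd number after it, so the path after `τ`
starts upwards and ends downwards both before and after the reflection; the same intervals between
reversals occur in the opposite order, and those spent upwards are exchanged with those spent
downwards. The displacement after `τ` therefore changes sign (`signIntegral_reflectPoints`). The
involution preserves the volume because `τ` depends only on the points before it, so that, once the
set of indices of these points is fixed, the other coordinates are reflected about a centre that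
does not involve them (`measurePreserving_reflectPoints`).

Finally, the endpoint has no atoms, so the tail of the maximum is twice the tail of the endpoint,
which gives the law of the maximum.
-/

namespace Telegraph

/-! ### Integrals of alternating signs along a counting path -/

/-- The position at time `s` of a particle that starts at `0` and whose velocity at time `r`
is `(-1) ^ x r`. -/
noncomputable def signIntegral (x : ℝ → ℕ) (s : ℝ) : ℝ := ∫ r in (0 : ℝ)..s, (-1 : ℝ) ^ x r

/-- The supremum of `signIntegral x` over `[0, t]`. -/
noncomputable def signPeak (x : ℝ → ℕ) (t : ℝ) : ℝ := sSup (signIntegral x '' Icc 0 t)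

theorem position_eq_mul_signIntegral {Ω : Type*} (V : Ω → ℝ) (N : ℝ≥0 → Ω → ℕ) (t : ℝ≥0) (ω : Ω) :
    position V N t ω = V ω * signIntegral (fun r => N r.toNNReal ω) t := by
  simp [position, signIntegral]

open scoped Pointwise in
theorem maximum_eq_mul_signPeak {Ω : Type*} (V : Ω → ℝ) (N : ℝ≥0 → Ω → ℕ) (t : ℝ≥0) (ω : Ω)
    (hV : 0 ≤ V ω) : maximum V N t ω = V ω * signPeak (fun r => N r.toNNReal ω) t := by
  have : (fun s => position V N s ω) '' Icc 0 t
      = V ω • (signIntegral (fun r => N r.toNNReal ω) '' Icc 0 (t : ℝ)) := by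
    ext y
    simp only [Set.mem_smul_set, mem_image, mem_Icc, smul_eq_mul]
    constructor
    · rintro ⟨s, hs, rfl⟩
      exact ⟨_, ⟨s, ⟨s.2, NNReal.coe_le_coe.2 hs.2⟩, rfl⟩,
        (position_eq_mul_signIntegral V N s ω).symm⟩
    · rintro ⟨_, ⟨s, hs, rfl⟩, rfl⟩
      exact ⟨⟨s, hs.1⟩, ⟨zero_le, NNReal.coe_le_coe.1 hs.2⟩,
        position_eq_mul_signIntegral V N ⟨s, hs.1⟩ ω⟩
  rw [maximum, this, Real.sSup_smul_of_nonneg hV, smul_eq_mul, signPeak]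

theorem measurable_neg_one_pow {α : Type*} [MeasurableSpace α] {x : α → ℕ} (hx : Measurable x) :
    Measurable fun r => (-1 : ℝ) ^ x r :=
  (measurable_from_top (f := fun n : ℕ => (-1 : ℝ) ^ n)).comp hx

theorem intervalIntegrable_neg_one_pow {x : ℝ → ℕ} (hx : Measurable x) (a b : ℝ) :
    IntervalIntegrable (fun r => (-1 : ℝ) ^ x r) volume a b :=
  (intervalIntegrable_const (c := (1 : ℝ))).mono_fun
    (measurable_neg_one_pow hx).aestronglyMeasurable (Filter.Eventually.of_forall fun s => by simp)

theorem signIntegral_zero (x : ℝ → ℕ) : signIntegral x 0 = 0 := by simp [signIntegral]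

theorem signIntegral_sub {x : ℝ → ℕ} (hx : Measurable x) (r s : ℝ) :
    signIntegral x s - signIntegral x r = ∫ u in r..s, (-1 : ℝ) ^ x u :=
  intervalIntegral.integral_interval_sub_left (intervalIntegrable_neg_one_pow hx _ _)
    (intervalIntegrable_neg_one_pow hx _ _)

theorem abs_signIntegral_sub_le {x : ℝ → ℕ} (hx : Measurable x) (r s : ℝ) :
    |signIntegral x s - signIntegral x r| ≤ |s - r| := by
  rw [signIntegral_sub hx]
  simpa using intervalIntegral.norm_integral_le_of_norm_le_const (a := r) (b := s) (C := 1)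
    (f := fun u => (-1 : ℝ) ^ x u) (fun u _ => by simp)

theorem abs_signIntegral_le {x : ℝ → ℕ} (hx : Measurable x) {s : ℝ} (hs : 0 ≤ s) :
    |signIntegral x s| ≤ s := by
  simpa [signIntegral_zero, abs_of_nonneg hs] using abs_signIntegral_sub_le hx 0 s

theorem continuous_signIntegral {x : ℝ → ℕ} (hx : Measurable x) : Continuous (signIntegral x) :=
  intervalIntegral.continuous_primitive (intervalIntegrable_neg_one_pow hx) 0

theorem bddAbove_signIntegral {x : ℝ → ℕ} (hx : Measurable x) (t : ℝ) :
    BddAbove (signIntegral x '' Icc 0 t) :=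
  (isCompact_Icc.image (continuous_signIntegral hx)).bddAbove

theorem lt_signPeak_iff {x : ℝ → ℕ} (hx : Measurable x) {t : ℝ} (ht : 0 ≤ t) {b : ℝ} :
    b < signPeak x t ↔ ∃ s ∈ Icc 0 t, b < signIntegral x s := by
  rw [signPeak, lt_csSup_iff (bddAbove_signIntegral hx t) ((nonempty_Icc.2 ht).image _)]
  simp

theorem signIntegral_le_signPeak {x : ℝ → ℕ} (hx : Measurable x) {s t : ℝ} (hs : s ∈ Icc 0 t) :
    signIntegral x s ≤ signPeak x t :=
  le_csSup (bddAbove_signIntegral hx t) (mem_image_of_mem _ hs)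

theorem signPeak_le_iff {x : ℝ → ℕ} (hx : Measurable x) {t : ℝ} (ht : 0 ≤ t) {b : ℝ} :
    signPeak x t ≤ b ↔ ∀ s ∈ Icc 0 t, signIntegral x s ≤ b := by
  simpa using (lt_signPeak_iff hx ht (b := b)).not

theorem signPeak_le {x : ℝ → ℕ} (hx : Measurable x) {t : ℝ} (ht : 0 ≤ t) : signPeak x t ≤ t :=
  (signPeak_le_iff hx ht).2 fun _ hs =>
    ((le_abs_self _).trans (abs_signIntegral_le hx hs.1)).trans hs.2

theorem abs_signIntegral_sub_signIntegral_le {x y : ℝ → ℕ} (hx : Measurable x) (hy : Measurable y)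
    {s t : ℝ} (hs : s ∈ Icc 0 t) :
    |signIntegral x s - signIntegral y s| ≤ ∫ r in (0 : ℝ)..t, |(-1 : ℝ) ^ x r - (-1) ^ y r| := by
  have hi := fun a b => (intervalIntegrable_neg_one_pow hx a b).sub
    (intervalIntegrable_neg_one_pow hy a b)
  rw [signIntegral, signIntegral, ← intervalIntegral.integral_sub
    (intervalIntegrable_neg_one_pow hx _ _) (intervalIntegrable_neg_one_pow hy _ _)]
  refine (intervalIntegral.abs_integral_le_integral_abs hs.1).trans ?_
  exact intervalIntegral.integral_mono_interval le_rfl hs.1 hs.2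
    (Filter.Eventually.of_forall fun r => abs_nonneg _) (hi 0 t).abs

theorem abs_signPeak_sub_signPeak_le {x y : ℝ → ℕ} (hx : Measurable x) (hy : Measurable y)
    {t : ℝ} (ht : 0 ≤ t) :
    |signPeak x t - signPeak y t| ≤ ∫ r in (0 : ℝ)..t, |(-1 : ℝ) ^ x r - (-1) ^ y r| := by
  have key : ∀ {x y : ℝ → ℕ}, Measurable x → Measurable y →
      signPeak x t ≤ signPeak y t + ∫ r in (0 : ℝ)..t, |(-1 : ℝ) ^ x r - (-1) ^ y r| := by
    intro x y hx hy
    refine (signPeak_le_iff hx ht).2 fun s hs => ?_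
    have h1 := abs_signIntegral_sub_signIntegral_le hx hy hs
    have h2 := signIntegral_le_signPeak hy hs
    linarith [le_abs_self (signIntegral x s - signIntegral y s)]
  have h1 := key hx hy
  have h2 := key hy hx
  simp_rw [abs_sub_comm ((-1 : ℝ) ^ y _)] at h2
  rw [abs_le]
  constructor <;> linarith

/-! ### Sampling a counting path on a grid -/

/-- The increments of `x` over the `n` cells of the regular grid on `[0, t]`; the subtraction of
natural numbers does not truncate when `x` is monotone. -/
noncomputable def cellIncrement (x : ℝ → ℕ) (t : ℝ) (n : ℕ) (i : Fin n) : ℕ :=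
  x ((i + 1 : ℕ) * t / n) - x ((i : ℕ) * t / n)

/-- The counting path that jumps by `a i` just after the left endpoint of the `i`-th of the `n`
cells of `[0, t]`. -/
noncomputable def gridPath (t : ℝ) (n : ℕ) (a : Fin n → ℕ) (r : ℝ) : ℕ :=
  ∑ i : Fin n, if (i : ℕ) * t / n < r then a i else 0

theorem measurable_gridPath (t : ℝ) (n : ℕ) (a : Fin n → ℕ) : Measurable (gridPath t n a) := by
  refine Finset.measurable_sum _ fun i _ => Measurable.ite ?_ measurable_const measurable_const
  exact measurableSet_Ioi

/-- On `(0, t)`, sampling the increments of `x` on the grid replaces the value of `x` at `r` by its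
value at the next grid point. -/
theorem gridPath_cellIncrement {x : ℝ → ℕ} (hx : Monotone x) (h0 : x 0 = 0) {t r : ℝ}
    (hr : r ∈ Ioo 0 t) {n : ℕ} (hn : 0 < n) :
    gridPath t n (cellIncrement x t n) r = x (⌈r * n / t⌉₊ * t / n) := by
  have ht : 0 < t := hr.1.trans hr.2
  have hn' : (0 : ℝ) < n := by exact_mod_cast hn
  set K := ⌈r * n / t⌉₊ with hK
  have hKn : K ≤ n := by
    rw [hK, Nat.ceil_le, div_le_iff₀ ht]
    nlinarith [hr.2]
  have hiff : ∀ i : ℕ, (i : ℝ) * t / n < r ↔ i < K := by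
    intro i
    rw [hK, Nat.lt_ceil, lt_div_iff₀ ht, div_lt_iff₀ hn']
  unfold gridPath cellIncrement
  simp_rw [hiff]
  rw [Fin.sum_univ_eq_sum_range
    (fun i => if i < K then x ((i + 1 : ℕ) * t / n) - x ((i : ℕ) * t / n) else 0) n,
    ← Finset.sum_filter]
  have hf : (Finset.range n).filter (· < K) = Finset.range K := by
    ext i; simp only [Finset.mem_filter, Finset.mem_range]; omega
  rw [hf, Finset.sum_range_tsub (f := fun i : ℕ => x ((i : ℕ) * t / n))]
  · simp [h0]
  · intro i j hij
    apply hx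
    gcongr

theorem eventually_gridPath_cellIncrement_eq {x : ℝ → ℕ} (hx : Monotone x) (h0 : x 0 = 0)
    {t r : ℝ} (hr : r ∈ Ioo 0 t) (hc : ContinuousWithinAt x (Ici r) r) :
    ∀ᶠ n : ℕ in Filter.atTop, gridPath t n (cellIncrement x t n) r = x r := by
  have ht : 0 < t := hr.1.trans hr.2
  have h1 : ∀ᶠ s in nhdsWithin r (Ici r), x s = x r := by
    have := hc (mem_nhds_discrete.2 rfl : {x r} ∈ nhds (x r))
    exact this
  have h2 : Filter.Tendsto (fun n : ℕ => (⌈r * n / t⌉₊ * t / n : ℝ)) Filter.atTop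
      (nhdsWithin r (Ici r)) := by
    refine tendsto_nhdsWithin_iff.2 ⟨?_, ?_⟩
    · have h3 : Filter.Tendsto (fun n : ℕ => r + t / n) Filter.atTop (nhds r) := by
        simpa using (tendsto_const_div_atTop_nhds_zero_nat t).const_add r
      refine tendsto_of_tendsto_of_tendsto_of_le_of_le' tendsto_const_nhds h3 ?_ ?_
      · filter_upwards [Filter.eventually_gt_atTop 0] with n hn
        have hn' : (0 : ℝ) < n := by exact_mod_cast hn
        rw [le_div_iff₀ hn', ← div_le_iff₀ ht]
        exact Nat.le_ceil _
      · filter_upwards [Filter.eventually_gt_atTop 0] with n hn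
        have hn' : (0 : ℝ) < n := by exact_mod_cast hn
        have hp : 0 ≤ r * n / t := by have := hr.1; positivity
        have := (Nat.ceil_lt_add_one hp).le
        calc (⌈r * n / t⌉₊ * t / n : ℝ) ≤ (r * n / t + 1) * t / n := by gcongr
          _ = r + t / n := by field_simp
    · filter_upwards [Filter.eventually_gt_atTop 0] with n hn
      have hn' : (0 : ℝ) < n := by exact_mod_cast hn
      rw [mem_Ici, le_div_iff₀ hn', ← div_le_iff₀ ht]
      exact Nat.le_ceil _
  filter_upwards [h2.eventually h1, Filter.eventually_gt_atTop 0] with n hn hn0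
  rw [gridPath_cellIncrement hx h0 hr hn0, hn]

theorem tendsto_integral_abs_gridPath_sub {x : ℝ → ℕ} (hx : Monotone x) (h0 : x 0 = 0)
    {t : ℝ} (ht : 0 < t) (hc : ∀ r, ContinuousWithinAt x (Ici r) r) :
    Filter.Tendsto (fun n : ℕ => ∫ r in (0 : ℝ)..t,
      |(-1 : ℝ) ^ gridPath t n (cellIncrement x t n) r - (-1) ^ x r|) Filter.atTop (nhds 0) := by
  suffices key : Filter.Tendsto (fun n : ℕ => ∫ r in (0 : ℝ)..t,
      |(-1 : ℝ) ^ gridPath t n (cellIncrement x t n) r - (-1) ^ x r|) Filter.atTop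
      (nhds (∫ _ in (0 : ℝ)..t, (0 : ℝ))) by
    simpa using key
  refine intervalIntegral.tendsto_integral_filter_of_dominated_convergence (fun _ => 2) ?_ ?_
    intervalIntegrable_const ?_
  · refine Filter.Eventually.of_forall fun n => ?_
    exact (((measurable_neg_one_pow (measurable_gridPath t n _)).sub
      (measurable_neg_one_pow hx.measurable)).abs).aestronglyMeasurable
  · refine Filter.Eventually.of_forall fun n => Filter.Eventually.of_forall fun r _ => ?_
    rw [Real.norm_eq_abs, abs_abs]
    refine (abs_sub _ _).trans ?_
    norm_num [abs_pow]
  · have hne : ∀ᵐ r : ℝ, r ≠ t := Measure.ae_ne volume t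
    filter_upwards [hne] with r hrt hr
    rw [uIoc_of_le ht.le] at hr
    refine tendsto_const_nhds.congr' ?_
    filter_upwards [eventually_gridPath_cellIncrement_eq hx h0
      ⟨hr.1, lt_of_le_of_ne hr.2 hrt⟩ (hc r)] with n hn
    simp [hn]

/-- The endpoint and the peak of the sampled paths converge to those of the path. -/
theorem tendsto_signIntegral_signPeak_gridPath {x : ℝ → ℕ} (hx : Monotone x) (h0 : x 0 = 0)
    {t : ℝ} (ht : 0 < t) (hc : ∀ r, ContinuousWithinAt x (Ici r) r) :
    Filter.Tendsto (fun n : ℕ =>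
      (signIntegral (gridPath t n (cellIncrement x t n)) t,
        signPeak (gridPath t n (cellIncrement x t n)) t)) Filter.atTop
      (nhds (signIntegral x t, signPeak x t)) := by
  have hI := tendsto_integral_abs_gridPath_sub hx h0 ht hc
  refine Filter.Tendsto.prodMk_nhds ?_ ?_
  · rw [tendsto_iff_dist_tendsto_zero]
    exact squeeze_zero (fun _ => dist_nonneg) (fun n => abs_signIntegral_sub_signIntegral_le
      (measurable_gridPath t n _) hx.measurable (right_mem_Icc.2 ht.le)) hI
  · rw [tendsto_iff_dist_tendsto_zero]
    exact squeeze_zero (fun _ => dist_nonneg) (fun n => abs_signPeak_sub_signPeak_le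
      (measurable_gridPath t n _) hx.measurable ht.le) hI

/-! ### Uniform points in an interval -/

/-- The number of `i ∈ A` with `u i ≤ r`: the counting path of the points `u i`, `i ∈ A`. -/
noncomputable def pointCount {ι : Type*} (A : Finset ι) (u : ι → ℝ) (r : ℝ) : ℕ :=
  (A.filter fun i => u i ≤ r).card

/-- The law of `m` independent points, uniform on `(0, t)`. -/
noncomputable def uniformPoints (m : ℕ) (t : ℝ) : Measure (Fin m → ℝ) :=
  (volume : Measure (Fin m → ℝ))[|univ.pi fun _ => Ioo 0 t]

theorem monotone_pointCount {ι : Type*} (A : Finset ι) (u : ι → ℝ) : Monotone (pointCount A u) :=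
  fun _ _ hab => Finset.card_le_card
    (Finset.monotone_filter_right _ fun _ _ hi => hi.trans hab)

theorem continuousWithinAt_pointCount {ι : Type*} (A : Finset ι) (u : ι → ℝ) (r : ℝ) :
    ContinuousWithinAt (pointCount A u) (Ici r) r := by
  have : ∀ᶠ s in nhdsWithin r (Ici r), ∀ i ∈ A, u i ≤ s ↔ u i ≤ r := by
    refine (Filter.eventually_all_finset A).2 fun i _ => ?_
    rcases le_or_gt (u i) r with h | h
    · filter_upwards [self_mem_nhdsWithin] with s hs
      exact ⟨fun _ => h, fun _ => h.trans hs⟩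
    · filter_upwards [nhdsWithin_le_nhds (Iio_mem_nhds h)] with s hs
      exact ⟨fun h' => absurd h' (not_le.2 hs), fun h' => absurd h' (not_le.2 h)⟩
  refine tendsto_const_nhds.congr' ?_
  filter_upwards [this] with s hs
  unfold pointCount
  rw [Finset.filter_congr hs]

theorem measurable_pointCount {α ι : Type*} [MeasurableSpace α] (A : Finset ι) {u : α → ι → ℝ}
    (hu : ∀ i, Measurable fun z => u z i) {r : α → ℝ} (hr : Measurable r) :
    Measurable fun z => pointCount A (u z) (r z) := by
  unfold pointCount
  simp_rw [Finset.card_filter]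
  exact Finset.measurable_sum _ fun i _ =>
    Measurable.ite (measurableSet_le (hu i) hr) measurable_const measurable_const

theorem volume_cube_Ioo (m : ℕ) {t : ℝ} (ht : 0 ≤ t) :
    (volume : Measure (Fin m → ℝ)) (univ.pi fun _ => Ioo 0 t) = ENNReal.ofReal (t ^ m) := by
  rw [volume_pi_pi]
  simp [ENNReal.ofReal_pow ht]

theorem isProbabilityMeasure_uniformPoints (m : ℕ) {t : ℝ} (ht : 0 < t) :
    IsProbabilityMeasure (uniformPoints m t) := by
  refine cond_isProbabilityMeasure_of_finite ?_ ?_ <;> rw [volume_cube_Ioo m ht.le]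
  · simpa using pow_pos ht m
  · simp

theorem measurableSet_cube (m : ℕ) (t : ℝ) :
    MeasurableSet (univ.pi fun _ : Fin m => Ioo 0 t) :=
  MeasurableSet.univ_pi fun _ => measurableSet_Ioo

theorem uniformPoints_real_apply (m : ℕ) {t : ℝ} (ht : 0 ≤ t) (s : Set (Fin m → ℝ)) :
    (uniformPoints m t).real s =
      (t ^ m)⁻¹ * (volume : Measure (Fin m → ℝ)).real ((univ.pi fun _ => Ioo 0 t) ∩ s) := by
  rw [uniformPoints, measureReal_def, cond_apply (measurableSet_cube m t), ENNReal.toReal_mul,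
    ENNReal.toReal_inv, volume_cube_Ioo m ht, ENNReal.toReal_ofReal (by positivity),
    ← measureReal_def]

theorem ae_uniformPoints_mem (m : ℕ) (t : ℝ) :
    ∀ᵐ u ∂uniformPoints m t, ∀ i, u i ∈ Ioo 0 t := by
  filter_upwards [ae_cond_mem (μ := (volume : Measure (Fin m → ℝ))) (measurableSet_cube m t)]
    with u hu i
  exact hu i trivial

/-- The number of maps with prescribed fibre sizes is a multinomial coefficient. -/
theorem card_filter_fiber_mul_prod_factorial {m n : ℕ} (a : Fin n → ℕ) (ha : ∑ i, a i = m) :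
    (Finset.univ.filter fun f : Fin m → Fin n =>
      ∀ i, (Finset.univ.filter fun j => f j = i).card = a i).card * ∏ i, (a i)! = m ! := by
  -- Compare the coefficients of `X ^ a` in the two expansions of `(∑ i, X i) ^ m`.
  have h1 : (∑ i : Fin n, (MvPolynomial.X i : MvPolynomial (Fin n) ℕ)) ^ m =
      ∑ f : Fin m → Fin n, ∏ i, MvPolynomial.X i ^ (Finset.univ.filter fun j => f j = i).card := by
    rw [← Fin.prod_const, Finset.prod_univ_sum]
    simp only [Fintype.piFinset_univ]
    refine Finset.sum_congr rfl fun f _ => ?_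
    rw [← Finset.prod_fiberwise_of_maps_to (s := Finset.univ) (t := Finset.univ) (g := f)
      (fun _ _ => Finset.mem_univ _)]
    refine Finset.prod_congr rfl fun i _ => ?_
    rw [Finset.prod_congr rfl (g := fun _ => MvPolynomial.X i)
      (fun j hj => by rw [(Finset.mem_filter.1 hj).2]), Finset.prod_const]
  have h2 := Finset.sum_pow_eq_sum_piAntidiag Finset.univ
    (fun i : Fin n => (MvPolynomial.X i : MvPolynomial (Fin n) ℕ)) m
  have hmon : ∀ b : Fin n → ℕ, ∏ i, (MvPolynomial.X i : MvPolynomial (Fin n) ℕ) ^ b i =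
      MvPolynomial.monomial (Finsupp.equivFunOnFinite.symm b) 1 := by
    intro b
    rw [MvPolynomial.monomial_eq, Finsupp.prod_fintype _ _ (by simp)]
    simp
  have h3 := congrArg (MvPolynomial.coeff (Finsupp.equivFunOnFinite.symm a)) (h1.symm.trans h2)
  simp_rw [hmon] at h3
  rw [MvPolynomial.coeff_sum, MvPolynomial.coeff_sum] at h3
  have hc : ∀ (p : ℕ) (q : MvPolynomial (Fin n) ℕ), (p : MvPolynomial (Fin n) ℕ) * q =
    MvPolynomial.C p * q := fun p q => by simp
  simp_rw [hc, MvPolynomial.coeff_C_mul, MvPolynomial.coeff_monomial,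
    EmbeddingLike.apply_eq_iff_eq] at h3
  simp only [mul_ite, mul_one, mul_zero, Finset.sum_ite_eq', Finset.mem_piAntidiag, ha,
    Finset.mem_univ, implies_true, and_self, if_true] at h3
  rw [Finset.sum_boole] at h3
  simp_rw [funext_iff] at h3
  rw [mul_comm]
  have h4 := Nat.multinomial_spec Finset.univ a
  rw [ha] at h4
  rw [← h4]
  congr 1

theorem sum_cellIncrement {x : ℝ → ℕ} (hx : Monotone x) {t : ℝ} (ht : 0 ≤ t) {n : ℕ}
    (hn : 0 < n) : ∑ i, cellIncrement x t n i = x t - x 0 := by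
  unfold cellIncrement
  rw [Fin.sum_univ_eq_sum_range (fun i => x ((i + 1 : ℕ) * t / n) - x ((i : ℕ) * t / n)) n,
    Finset.sum_range_tsub (f := fun i : ℕ => x ((i : ℕ) * t / n))]
  · have hn' : (n : ℝ) ≠ 0 := by positivity
    rw [mul_div_cancel_left₀ _ hn']
    simp
  · intro i j hij
    apply hx
    gcongr

theorem mem_cell_iff {t r : ℝ} (ht : 0 < t) {n : ℕ} (hn : 0 < n) (i : ℕ) :
    r ∈ Ioc ((i : ℕ) * t / n) ((i + 1 : ℕ) * t / n) ↔ ⌈r * n / t⌉₊ = i + 1 := by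
  have hn' : (0 : ℝ) < n := by exact_mod_cast hn
  rw [Nat.ceil_eq_iff (Nat.succ_ne_zero i), mem_Ioc, div_lt_iff₀ hn', lt_div_iff₀ ht,
    div_le_iff₀ ht, le_div_iff₀ hn']
  simp

theorem cellIncrement_pointCount {m : ℕ} {u : Fin m → ℝ} {t : ℝ} (ht : 0 < t) {n : ℕ}
    (hn : 0 < n) {f : Fin m → Fin n}
    (hf : ∀ j, u j ∈ Ioc (((f j : ℕ) : ℝ) * t / n) (((f j + 1 : ℕ) : ℝ) * t / n)) (i : Fin n) :
    cellIncrement (pointCount Finset.univ u) t n i =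
      (Finset.univ.filter fun j => f j = i).card := by
  unfold cellIncrement pointCount
  have hle : ((i : ℕ) : ℝ) * t / n ≤ ((i + 1 : ℕ) : ℝ) * t / n := by
    gcongr; omega
  rw [← Finset.card_sdiff_of_subset
    (Finset.monotone_filter_right _ fun _ _ h => le_trans h hle)]
  congr 1
  ext j
  simp only [Finset.mem_sdiff, Finset.mem_filter, Finset.mem_univ, true_and, not_le]
  have h1 := (mem_cell_iff (r := u j) ht hn (f j)).1 (hf j)
  have h2 := mem_cell_iff (r := u j) ht hn i
  rw [h1, mem_Ioc, Nat.add_right_cancel_iff, ← Fin.ext_iff] at h2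
  rw [← h2, and_comm]

/-- The numbers of uniform points in the cells of a regular grid have a multinomial law. -/
theorem uniformPoints_real_cellIncrement {m : ℕ} {t : ℝ} (ht : 0 < t) {n : ℕ} (hn : 0 < n)
    (a : Fin n → ℕ) (ha : ∑ i, a i = m) :
    (uniformPoints m t).real {u | cellIncrement (pointCount Finset.univ u) t n = a} =
      (m ! : ℝ) / (∏ i, (a i)! : ℕ) / (n : ℝ) ^ m := by
  have hn' : (0 : ℝ) < n := by exact_mod_cast hn
  rw [uniformPoints_real_apply m ht.le]
  set S := {u : Fin m → ℝ | cellIncrement (pointCount Finset.univ u) t n = a} with hS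
  set F := Finset.univ.filter fun f : Fin m → Fin n =>
      ∀ i, (Finset.univ.filter fun j => f j = i).card = a i with hF
  let cell : Fin n → Set ℝ := fun i => Ioc ((i : ℕ) * t / n) ((i + 1 : ℕ) * t / n)
  have h1 : (volume : Measure (Fin m → ℝ)).real ((univ.pi fun _ => Ioo 0 t) ∩ S) =
      (volume : Measure (Fin m → ℝ)).real ((univ.pi fun _ => Ioc 0 t) ∩ S) := by
    refine measureReal_congr (Filter.EventuallyEq.inter ?_ Filter.EventuallyEq.rfl)
    exact (Measure.univ_pi_Ioo_ae_eq_Icc (μ := fun _ : Fin m => (volume : Measure ℝ))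
      (f := fun _ => 0) (g := fun _ => t)).trans (Measure.univ_pi_Ioc_ae_eq_Icc).symm
  have h2 : (univ.pi fun _ => Ioc 0 t) ∩ S = ⋃ f ∈ F, univ.pi fun j => cell (f j) := by
    ext u
    simp only [mem_inter_iff, mem_iUnion, exists_prop, hF, Finset.mem_filter, Finset.mem_univ,
      true_and]
    constructor
    · rintro ⟨hu, hS'⟩
      have hex : ∀ j, ∃ i : Fin n, u j ∈ cell i := by
        intro j
        have hj := hu j trivial
        have hpos : 0 < ⌈u j * n / t⌉₊ := by
          rw [Nat.ceil_pos]; have := hj.1; positivity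
        have hle : ⌈u j * n / t⌉₊ ≤ n := by
          rw [Nat.ceil_le, div_le_iff₀ ht]; nlinarith [hj.2]
        refine ⟨⟨⌈u j * n / t⌉₊ - 1, by omega⟩, ?_⟩
        exact (mem_cell_iff ht hn _).2 (by simp only; omega)
      choose f hf using hex
      refine ⟨f, fun i => ?_, fun j _ => hf j⟩
      rw [← cellIncrement_pointCount ht hn hf, ← hS']
    · rintro ⟨f, hfa, hf⟩
      refine ⟨fun j _ => ?_, ?_⟩
      · have hj := hf j trivial
        refine ⟨lt_of_le_of_lt (by positivity) hj.1, hj.2.trans ?_⟩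
        rw [div_le_iff₀ hn', mul_comm]
        gcongr
        exact (f j).2
      · funext i
        rw [cellIncrement_pointCount ht hn (fun j => hf j trivial), hfa]
  have h3 : ∀ f : Fin m → Fin n,
      (volume : Measure (Fin m → ℝ)) (univ.pi fun j => cell (f j)) =
        ENNReal.ofReal ((t / n) ^ m) := by
    intro f
    rw [volume_pi_pi]
    simp only [cell, Real.volume_Ioc]
    rw [Finset.prod_congr rfl (g := fun _ => ENNReal.ofReal (t / n))]
    · simp [ENNReal.ofReal_pow (by positivity : 0 ≤ t / n)]
    · intro j _
      congr 1
      push_cast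
      ring
  have h4 : (volume : Measure (Fin m → ℝ)) ((univ.pi fun _ => Ioc 0 t) ∩ S) =
      F.card * ENNReal.ofReal ((t / n) ^ m) := by
    rw [h2, measure_biUnion_finset]
    · simp [h3]
    · intro f _ g _ hfg
      rw [Function.onFun, Set.disjoint_left]
      intro u hu hu'
      refine hfg (funext fun j => Fin.ext ?_)
      have e1 := (mem_cell_iff ht hn _).1 (hu j trivial)
      have e2 := (mem_cell_iff ht hn _).1 (hu' j trivial)
      omega
    · intro f _
      exact MeasurableSet.univ_pi fun j => measurableSet_Ioc
  have h5 := card_filter_fiber_mul_prod_factorial a ha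
  rw [h1, measureReal_def, h4, ENNReal.toReal_mul, ENNReal.toReal_natCast,
    ENNReal.toReal_ofReal (by positivity), ← h5]
  have hp : ((∏ i, (a i)! : ℕ) : ℝ) ≠ 0 := by
    exact_mod_cast (Finset.prod_pos fun i _ => Nat.factorial_pos (a i)).ne'
  rw [Nat.cast_mul, mul_div_cancel_right₀ _ hp, div_pow]
  field_simp
  rfl

/-! ### Equality in law of counting paths -/

/-- Two random counting paths with the same increments in law on every regular grid of `[0, t]`
give the same joint law to the endpoint and the peak of the integrated signs. -/
theorem identDistrib_signIntegral_signPeak {Ω₁ Ω₂ : Type*} [MeasurableSpace Ω₁]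
    [MeasurableSpace Ω₂] {μ₁ : Measure Ω₁} {μ₂ : Measure Ω₂} [IsProbabilityMeasure μ₁]
    [IsProbabilityMeasure μ₂] {x₁ : Ω₁ → ℝ → ℕ} {x₂ : Ω₂ → ℝ → ℕ}
    {t : ℝ} (ht : 0 < t)
    (h₁ : ∀ᵐ ω ∂μ₁, Monotone (x₁ ω) ∧ x₁ ω 0 = 0 ∧
      ∀ r, ContinuousWithinAt (x₁ ω) (Ici r) r)
    (h₂ : ∀ᵐ ω ∂μ₂, Monotone (x₂ ω) ∧ x₂ ω 0 = 0 ∧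
      ∀ r, ContinuousWithinAt (x₂ ω) (Ici r) r)
    (hx : ∀ n, 0 < n → IdentDistrib (fun ω => cellIncrement (x₁ ω) t n)
      (fun ω => cellIncrement (x₂ ω) t n) μ₁ μ₂) :
    IdentDistrib (fun ω => (signIntegral (x₁ ω) t, signPeak (x₁ ω) t))
      (fun ω => (signIntegral (x₂ ω) t, signPeak (x₂ ω) t)) μ₁ μ₂ := by
  let G : (n : ℕ) → (Fin n → ℕ) → ℝ × ℝ := fun n a =>
    (signIntegral (gridPath t n a) t, signPeak (gridPath t n a) t)
  have hG : ∀ n, Measurable (G n) := fun n => measurable_of_countable _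
  have hI : ∀ n, IdentDistrib (fun ω => G (n + 1) (cellIncrement (x₁ ω) t (n + 1)))
      (fun ω => G (n + 1) (cellIncrement (x₂ ω) t (n + 1))) μ₁ μ₂ := fun n =>
    (hx (n + 1) n.succ_pos).comp (hG (n + 1))
  have l₁ : ∀ᵐ ω ∂μ₁, Filter.Tendsto (fun n : ℕ => G (n + 1) (cellIncrement (x₁ ω) t (n + 1)))
      Filter.atTop (nhds (signIntegral (x₁ ω) t, signPeak (x₁ ω) t)) := by
    filter_upwards [h₁] with ω h
    exact (tendsto_signIntegral_signPeak_gridPath h.1 h.2.1 ht h.2.2).comp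
      (Filter.tendsto_add_atTop_nat 1)
  have l₂ : ∀ᵐ ω ∂μ₂, Filter.Tendsto (fun n : ℕ => G (n + 1) (cellIncrement (x₂ ω) t (n + 1)))
      Filter.atTop (nhds (signIntegral (x₂ ω) t, signPeak (x₂ ω) t)) := by
    filter_upwards [h₂] with ω h
    exact (tendsto_signIntegral_signPeak_gridPath h.1 h.2.1 ht h.2.2).comp
      (Filter.tendsto_add_atTop_nat 1)
  have m₁ := aemeasurable_of_tendsto_metrizable_ae _ (fun n => (hI n).aemeasurable_fst) l₁
  have m₂ := aemeasurable_of_tendsto_metrizable_ae _ (fun n => (hI n).aemeasurable_snd) l₂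
  refine ⟨m₁, m₂, ?_⟩
  have d₁ := (tendstoInMeasure_of_tendsto_ae
    (fun n => (hI n).aemeasurable_fst.aestronglyMeasurable)
    l₁).tendstoInDistribution_of_aemeasurable (fun n => (hI n).aemeasurable_fst) m₁
  have d₂ := (tendstoInMeasure_of_tendsto_ae
    (fun n => (hI n).aemeasurable_snd.aestronglyMeasurable)
    l₂).tendstoInDistribution_of_aemeasurable (fun n => (hI n).aemeasurable_snd) m₂
  have e : (fun n => (⟨μ₁.map _, Measure.isProbabilityMeasure_map (d₁.forall_aemeasurable n)⟩ :
      ProbabilityMeasure (ℝ × ℝ))) = fun n =>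
      ⟨μ₂.map _, Measure.isProbabilityMeasure_map (d₂.forall_aemeasurable n)⟩ := by
    funext n
    exact Subtype.ext (hI n).map_eq
  have h := d₁.tendsto
  rw [e] at h
  exact congrArg Subtype.val
    (tendsto_nhds_unique (X := ProbabilityMeasure (ℝ × ℝ)) h d₂.tendsto)

/-! ### A Poisson process given its value at time `t` -/

section Poisson

variable {Ω : Type*} [MeasurableSpace Ω] {P : Measure Ω} {rate : ℝ≥0} {N : ℝ≥0 → Ω → ℕ}

theorem IsPoissonProcess.measure_sub_eq (h : IsPoissonProcess rate N P) {s t : ℝ≥0} (hst : s ≤ t)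
    (j : ℕ) : P {ω | (N t ω : ℤ) - N s ω = j} =
      ENNReal.ofReal (Real.exp (-(rate * (t - s))) * (rate * (t - s)) ^ j / j !) := by
  have h1 := (h.law s t hst).measure_eq (p := fun z : ℤ => z = j) (measurableSet_singleton _)
  rw [h1, ofPred_eq_eq_singleton, Measure.map_apply measurable_from_top (measurableSet_singleton _)]
  have : (fun n : ℕ => (n : ℤ)) ⁻¹' {(j : ℤ)} = {j} := by ext; simp
  rw [this, poissonMeasure_singleton]
  push_cast [NNReal.coe_sub hst]
  rfl

theorem IsPoissonProcess.ae_path (h : IsPoissonProcess rate N P) :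
    ∀ᵐ ω ∂P, Monotone (fun r : ℝ => N r.toNNReal ω) ∧ N (0 : ℝ).toNNReal ω = 0 ∧
      ∀ r : ℝ, ContinuousWithinAt (fun r : ℝ => N r.toNNReal ω) (Ici r) r := by
  filter_upwards [h.path, h.zero] with ω hp h0
  refine ⟨fun a b hab => hp.1 (Real.toNNReal_mono hab), by simpa using h0, fun r => ?_⟩
  refine ContinuousWithinAt.comp (t := Ici r.toNNReal) (hp.2 r.toNNReal)
    continuous_real_toNNReal.continuousWithinAt fun s hs => Real.toNNReal_mono hs

theorem IsPoissonProcess.measure_eq (h : IsPoissonProcess rate N P) (t : ℝ≥0) (j : ℕ) :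
    P {ω | N t ω = j} = ENNReal.ofReal (Real.exp (-(rate * t)) * (rate * t) ^ j / j !) := by
  have h1 := h.measure_sub_eq (zero_le : 0 ≤ t) j
  simp only [NNReal.coe_zero, sub_zero] at h1
  rw [← h1]
  refine measure_congr ?_
  filter_upwards [h.zero] with ω h0
  apply propext
  change N t ω = j ↔ (N t ω : ℤ) - (N 0 ω : ℕ) = j
  rw [h0]
  simp

theorem measurable_cellIncrement {x : Ω → ℝ → ℕ} (hx : ∀ r, Measurable fun ω => x ω r) (t : ℝ)
    (n : ℕ) : Measurable fun ω => cellIncrement (x ω) t n :=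
  measurable_pi_lambda _ fun _ => (hx _).sub (hx _)

/-- The increments over the cells of a regular grid are independent Poisson variables. -/
theorem IsPoissonProcess.measure_cellIncrement (h : IsPoissonProcess rate N P) (t : ℝ≥0) {n : ℕ}
    (hn : 0 < n) (a : Fin n → ℕ) :
    P {ω | cellIncrement (fun r => N r.toNNReal ω) t n = a} =
      ENNReal.ofReal
        (Real.exp (-(rate * t)) * (rate * t / n) ^ (∑ i, a i) / (∏ i, (a i)! : ℕ)) := by
  have hn' : (0 : ℝ) < n := by exact_mod_cast hn
  let τ : Fin (n + 1) → ℝ≥0 := fun i => ((i : ℕ) * (t : ℝ) / n).toNNReal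
  have hτ : Monotone τ := fun i j hij => Real.toNNReal_mono (by gcongr; exact hij)
  have hτc : ∀ i, (τ i : ℝ) = (i : ℕ) * (t : ℝ) / n := fun i =>
    Real.coe_toNNReal _ (by positivity)
  have hi := h.indep n τ hτ
  have h1 : P {ω | cellIncrement (fun r => N r.toNNReal ω) t n = a} =
      P (⋂ i ∈ (Finset.univ : Finset (Fin n)),
        (fun ω => (N (τ i.succ) ω : ℤ) - N (τ i.castSucc) ω) ⁻¹' {(a i : ℤ)}) := by
    refine measure_congr ?_
    filter_upwards [h.path] with ω hω
    apply propext
    change cellIncrement (fun r => N r.toNNReal ω) t n = a ↔ ω ∈ (⋂ i ∈ _, _)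
    simp only [Finset.mem_univ, iInter_true, mem_iInter, mem_preimage, mem_singleton_iff,
      funext_iff]
    refine forall_congr' fun i => ?_
    have hm : N (τ i.castSucc) ω ≤ N (τ i.succ) ω := hω.1 (hτ (Fin.castSucc_lt_succ).le)
    have he : cellIncrement (fun r => N r.toNNReal ω) t n i =
      N (τ i.succ) ω - N (τ i.castSucc) ω := by simp [cellIncrement, τ]
    rw [he]
    omega
  rw [h1, hi.measure_inter_preimage_eq_mul Finset.univ (sets := fun i => {(a i : ℤ)})
    (fun i _ => measurableSet_singleton _)]
  have h2 : ∀ i : Fin n, P ((fun ω => (N (τ i.succ) ω : ℤ) - N (τ i.castSucc) ω) ⁻¹' {(a i : ℤ)}) =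
      ENNReal.ofReal (Real.exp (-(rate * t / n)) * (rate * t / n) ^ a i / (a i)!) := by
    intro i
    have := h.measure_sub_eq (hτ (Fin.castSucc_lt_succ (i := i)).le) (a i)
    rw [hτc, hτc] at this
    have e : ((i.succ : ℕ) : ℝ) * t / n - ((i.castSucc : ℕ) : ℝ) * t / n = t / n := by
      simp only [Fin.val_succ, Fin.val_castSucc]
      push_cast
      ring
    rw [e, ← mul_div_assoc] at this
    exact this
  rw [Finset.prod_congr rfl fun i _ => h2 i,
    ← ENNReal.ofReal_prod_of_nonneg (fun i _ => by positivity)]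
  congr 1
  rw [Finset.prod_div_distrib, Finset.prod_mul_distrib, Finset.prod_pow_eq_pow_sum,
    Finset.prod_const, Finset.card_univ, Fintype.card_fin, ← Real.exp_nat_mul]
  push_cast
  congr 3
  field_simp

end Poisson

section Telegraph

variable {Ω : Type*} [MeasurableSpace Ω] {P : Measure Ω} {rate : ℝ≥0}
  {c : ℝ} {V : Ω → ℝ} {N : ℝ≥0 → Ω → ℕ}

theorem IsSymmetricTelegraph.measurableSet_event (hT : IsSymmetricTelegraph rate c V N P)
    (t : ℝ≥0) (m : ℕ) : MeasurableSet {ω | V ω = c ∧ N t ω = m} :=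
  (hT.measurable_velocity (measurableSet_singleton c)).inter
    (hT.poisson.measurable t (measurableSet_singleton m))

theorem IsSymmetricTelegraph.measure_event (hT : IsSymmetricTelegraph rate c V N P)
    (t : ℝ≥0) (m : ℕ) : P {ω | V ω = c ∧ N t ω = m} = 2⁻¹ * P {ω | N t ω = m} := by
  have h := hT.indep.measure_inter_preimage_eq_mul {c} {x | x t = m} (measurableSet_singleton c)
    (measurableSet_eq_fun (measurable_pi_apply t) measurable_const)
  have hV : V ⁻¹' {c} = {ω | V ω = c} := rfl
  rw [hV, hT.velocity_pos] at h
  exact h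

/-- The cell increments determine `N t`, their sum, so that the condition on `N t` is redundant. -/
theorem IsSymmetricTelegraph.measure_event_inter (hT : IsSymmetricTelegraph rate c V N P)
    {t : ℝ≥0} {n : ℕ} (hn : 0 < n) (a : Fin n → ℕ) :
    P ({ω | V ω = c ∧ N t ω = ∑ i, a i} ∩
        {ω | cellIncrement (fun r => N r.toNNReal ω) t n = a}) =
      2⁻¹ * P {ω | cellIncrement (fun r => N r.toNNReal ω) t n = a} := by
  have h := hT.indep.measure_inter_preimage_eq_mul {c}
    {x | cellIncrement (fun r => x r.toNNReal) t n = a} (measurableSet_singleton c)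
    (measurable_cellIncrement (x := fun (x : ℝ≥0 → ℕ) r => x r.toNNReal)
      (fun r => measurable_pi_apply _) t n (measurableSet_singleton a))
  have hV : V ⁻¹' {c} = {ω | V ω = c} := rfl
  rw [hV, hT.velocity_pos] at h
  refine Eq.trans (measure_congr ?_) h
  filter_upwards [hT.poisson.ae_path] with ω hω
  apply propext
  change ((V ω = c ∧ N t ω = ∑ i, a i) ∧ cellIncrement (fun r => N r.toNNReal ω) t n = a) ↔
    (V ω = c ∧ cellIncrement (fun r => N r.toNNReal ω) t n = a)
  constructor
  · rintro ⟨⟨h1, _⟩, h2⟩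
    exact ⟨h1, h2⟩
  · rintro ⟨h1, h2⟩
    refine ⟨⟨h1, ?_⟩, h2⟩
    rw [← h2, sum_cellIncrement hω.1 t.coe_nonneg hn, hω.2.1]
    simp

theorem IsSymmetricTelegraph.measure_event_ne_zero (hT : IsSymmetricTelegraph rate c V N P)
    (hrate : 0 < rate) {t : ℝ≥0} (ht : 0 < t) (m : ℕ) : P {ω | V ω = c ∧ N t ω = m} ≠ 0 := by
  rw [hT.measure_event, hT.poisson.measure_eq]
  have h1 : (0 : ℝ) < rate := hrate
  have h2 : (0 : ℝ) < t := ht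
  simp only [ne_eq, mul_eq_zero, ENNReal.inv_eq_zero, ENNReal.ofNat_ne_top, false_or,
    ENNReal.ofReal_eq_zero, not_le]
  positivity

/-- Given `V = c` and `N t = m`, the increments of `N` over a regular grid of `[0, t]` are those of
the counting path of `m` uniform points. -/
theorem IsSymmetricTelegraph.identDistrib_cellIncrement [IsProbabilityMeasure P]
    (hT : IsSymmetricTelegraph rate c V N P)
    (hrate : 0 < rate) {t : ℝ≥0} (ht : 0 < t) (m : ℕ) {n : ℕ} (hn : 0 < n) :
    IdentDistrib (fun ω => cellIncrement (fun r => N r.toNNReal ω) t n)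
      (fun u => cellIncrement (pointCount Finset.univ u) t n)
      P[|{ω | V ω = c ∧ N t ω = m}] (uniformPoints m t) := by
  have ht' : (0 : ℝ) < t := ht
  have hr' : (0 : ℝ) < rate := hrate
  have hn' : (0 : ℝ) < n := by exact_mod_cast hn
  set E := {ω | V ω = c ∧ N t ω = m} with hE
  have hEm : MeasurableSet E := hT.measurableSet_event t m
  have hE0 : P E ≠ 0 := hT.measure_event_ne_zero hrate ht m
  have := cond_isProbabilityMeasure hE0
  have := isProbabilityMeasure_uniformPoints m ht'
  have m₁ : Measurable fun ω => cellIncrement (fun r => N r.toNNReal ω) t n :=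
    measurable_cellIncrement (fun r => hT.poisson.measurable _) t n
  have m₂ : Measurable fun u : Fin m → ℝ => cellIncrement (pointCount Finset.univ u) t n :=
    measurable_cellIncrement (fun r => measurable_pointCount _ (fun i => measurable_pi_apply i)
      measurable_const) t n
  refine ⟨m₁.aemeasurable, m₂.aemeasurable, Measure.ext_of_singleton fun a => ?_⟩
  rw [Measure.map_apply m₁ (measurableSet_singleton a),
    Measure.map_apply m₂ (measurableSet_singleton a)]
  by_cases ha : ∑ i, a i = m
  · rw [← ENNReal.toReal_eq_toReal_iff' (measure_ne_top _ _) (measure_ne_top _ _)]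
    have h2 := uniformPoints_real_cellIncrement ht' hn a ha
    refine Eq.trans ?_ h2.symm
    rw [cond_apply hEm, hE, hT.measure_event]
    subst ha
    change ENNReal.toReal (_ * P ({ω | V ω = c ∧ N t ω = ∑ i, a i} ∩
        {ω | cellIncrement (fun r => N r.toNNReal ω) t n = a})) = _
    rw [hT.measure_event_inter hn, hT.poisson.measure_eq, hT.poisson.measure_cellIncrement t hn,
      ENNReal.toReal_mul, ENNReal.toReal_inv, ENNReal.toReal_mul, ENNReal.toReal_mul,
      ENNReal.toReal_ofReal (by positivity), ENNReal.toReal_ofReal (by positivity)]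
    have hp : ((∏ i, (a i)! : ℕ) : ℝ) ≠ 0 := by
      exact_mod_cast (Finset.prod_pos fun i _ => Nat.factorial_pos (a i)).ne'
    have he := (Real.exp_pos (-(rate * t : ℝ))).ne'
    rw [div_pow]
    simp only [ENNReal.toReal_inv, ENNReal.toReal_ofNat]
    field_simp
  · have e₁ : P[|E] {ω | cellIncrement (fun r => N r.toNNReal ω) t n = a} = 0 := by
      have hp := (cond_absolutelyContinuous (μ := P) (s := E)).ae_le hT.poisson.ae_path
      have hq := ae_cond_mem (μ := P) hEm
      refine measure_eq_zero_iff_ae_notMem.2 ?_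
      filter_upwards [hp, hq] with ω h1 h2 h3
      apply ha
      rw [← h3, sum_cellIncrement h1.1 t.coe_nonneg hn, h1.2.1]
      simpa using h2.2
    have e₂ : uniformPoints m t {u | cellIncrement (pointCount Finset.univ u) t n = a} = 0 := by
      refine measure_eq_zero_iff_ae_notMem.2 ?_
      filter_upwards [ae_uniformPoints_mem m t] with u hu h3
      apply ha
      rw [← h3, sum_cellIncrement (monotone_pointCount _ u) t.coe_nonneg hn]
      unfold pointCount
      rw [Finset.filter_true_of_mem fun i _ => (hu i).2.le,
        Finset.filter_false_of_mem fun i _ => not_le.2 (hu i).1]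
      simp
    exact e₁.trans e₂.symm

/-- Given `V = c` and `N t = m`, the telegraph path has the endpoint and the peak of the path that
reverses at `m` uniform points. -/
theorem IsSymmetricTelegraph.identDistrib_signIntegral_signPeak [IsProbabilityMeasure P]
    (hT : IsSymmetricTelegraph rate c V N P) (hrate : 0 < rate) {t : ℝ≥0} (ht : 0 < t) (m : ℕ) :
    IdentDistrib
      (fun ω => (signIntegral (fun r => N r.toNNReal ω) t, signPeak (fun r => N r.toNNReal ω) t))
      (fun u => (signIntegral (pointCount Finset.univ u) t, signPeak (pointCount Finset.univ u) t))
      P[|{ω | V ω = c ∧ N t ω = m}] (uniformPoints m t) := by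
  have ht' : (0 : ℝ) < t := ht
  have := cond_isProbabilityMeasure (hT.measure_event_ne_zero hrate ht m)
  have := isProbabilityMeasure_uniformPoints m ht'
  refine Telegraph.identDistrib_signIntegral_signPeak ht' ?_ ?_
    fun n hn => hT.identDistrib_cellIncrement hrate ht m hn
  · exact cond_absolutelyContinuous.ae_le hT.poisson.ae_path
  · filter_upwards [ae_uniformPoints_mem m t] with u hu
    refine ⟨monotone_pointCount _ u, ?_, continuousWithinAt_pointCount _ u⟩
    unfold pointCount
    rw [Finset.filter_false_of_mem fun i _ => not_le.2 (hu i).1]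
    simp

end Telegraph

/-! ### The density of the endpoint for uniform reversal points -/

theorem measurable_signIntegral_pointCount {α ι : Type*} [MeasurableSpace α] (A : Finset ι)
    {u : α → ι → ℝ} (hu : ∀ i, Measurable fun z => u z i) {s : α → ℝ} (hs : Measurable s) :
    Measurable fun z => signIntegral (pointCount A (u z)) (s z) := by
  have hf : Measurable fun p : α × ℝ => (-1 : ℝ) ^ pointCount A (u p.1) p.2 :=
    measurable_neg_one_pow (measurable_pointCount A (fun i => (hu i).comp measurable_fst)
      measurable_snd)
  have hs1 : Measurable fun p : α × ℝ => s p.1 := hs.comp measurable_fst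
  have key : ∀ S : Set (α × ℝ), MeasurableSet S →
      Measurable fun z => ∫ r, S.indicator
        (fun p : α × ℝ => (-1 : ℝ) ^ pointCount A (u p.1) p.2) (z, r) := fun S hS =>
    ((hf.indicator hS).stronglyMeasurable.integral_prod_right' (ν := volume)).measurable
  have h1 := key {p | 0 < p.2 ∧ p.2 ≤ s p.1}
    ((measurableSet_lt measurable_const measurable_snd).inter
      (measurableSet_le measurable_snd hs1))
  have h2 := key {p | s p.1 < p.2 ∧ p.2 ≤ 0}
    ((measurableSet_lt hs1 measurable_snd).inter
      (measurableSet_le measurable_snd measurable_const))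
  convert h1.sub h2 using 1
  funext z
  rw [signIntegral, intervalIntegral, ← integral_indicator measurableSet_Ioc,
    ← integral_indicator measurableSet_Ioc]
  rfl

theorem signIntegral_congr {x y : ℝ → ℕ} {s : ℝ} (hs : 0 ≤ s) (h : ∀ r ∈ Ico 0 s, x r = y r) :
    signIntegral x s = signIntegral y s := by
  unfold signIntegral
  refine intervalIntegral.integral_congr_ae ?_
  filter_upwards [Measure.ae_ne volume s] with r hne hr
  rw [uIoc_of_le hs] at hr
  rw [h r ⟨hr.1.le, lt_of_le_of_ne hr.2 hne⟩]

theorem pointCount_insertNth {m : ℕ} (i : Fin (m + 1)) (s : ℝ) (v : Fin m → ℝ) (r : ℝ) :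
    pointCount Finset.univ (i.insertNth s v : Fin (m + 1) → ℝ) r =
      (if s ≤ r then 1 else 0) + pointCount Finset.univ v r := by
  unfold pointCount
  rw [Finset.card_filter, Finset.card_filter, Fin.sum_univ_succAbove _ i]
  simp

/-- The time before `t` at which the number of points `u i` passed differs in parity from `m`, the
total number of points: the particle then moves against its final direction. -/
noncomputable def oppositeTime {m : ℕ} (u : Fin m → ℝ) (t : ℝ) : ℝ :=
  (t - (-1) ^ m * signIntegral (pointCount Finset.univ u) t) / 2

theorem oppositeTime_insertNth {m : ℕ} (i : Fin (m + 1)) {s t : ℝ} (hs : 0 ≤ s) (hst : s ≤ t)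
    {v : Fin m → ℝ} (hv : ∀ j, v j < s) :
    oppositeTime (i.insertNth s v : Fin (m + 1) → ℝ) t = s - oppositeTime v s := by
  set u : Fin (m + 1) → ℝ := i.insertNth s v with hu
  have h1 : signIntegral (pointCount Finset.univ u) s =
      signIntegral (pointCount Finset.univ v) s := by
    refine signIntegral_congr hs fun r hr => ?_
    rw [hu, pointCount_insertNth, if_neg (not_le.2 hr.2), zero_add]
  have h2 := signIntegral_sub (monotone_pointCount Finset.univ u).measurable s t
  have h3 : ∫ r in s..t, (-1 : ℝ) ^ pointCount Finset.univ u r = (t - s) * (-1) ^ (m + 1) := by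
    rw [intervalIntegral.integral_congr (g := fun _ => (-1 : ℝ) ^ (m + 1))]
    · simp
    · intro r hr
      rw [uIcc_of_le hst] at hr
      have : pointCount Finset.univ v r = m := by
        unfold pointCount
        rw [Finset.filter_true_of_mem fun j _ => (hv j).le.trans hr.1]
        simp
      simp only
      rw [hu, pointCount_insertNth, if_pos hr.1, this, add_comm]
  rw [h3, h1] at h2
  have h4 : signIntegral (pointCount Finset.univ u) t =
    signIntegral (pointCount Finset.univ v) s + (t - s) * (-1) ^ (m + 1) := by linarith
  unfold oppositeTime
  rw [h4]
  have h5 : ((-1 : ℝ) ^ (m + 1)) * (-1) ^ (m + 1) = 1 := by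
    rw [← mul_pow]; simp
  linear_combination (t - s) * (-1 / 2) * h5 + (-1 / 2) *
    signIntegral (pointCount Finset.univ v) s * (pow_succ (-1 : ℝ) m)

theorem measurable_oppositeTime {α : Type*} [MeasurableSpace α] {m : ℕ} {u : α → Fin m → ℝ}
    (hu : Measurable u) {s : α → ℝ} (hs : Measurable s) :
    Measurable fun z => oppositeTime (u z) (s z) :=
  (hs.sub ((measurable_signIntegral_pointCount _ (fun i => (measurable_pi_apply i).comp hu)
    hs).const_mul _)).div_const 2

theorem volume_setOf_apply_eq_apply {m : ℕ} {i j : Fin m} (hij : i ≠ j) :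
    (volume : Measure (Fin m → ℝ)) {u | u i = u j} = 0 := by
  have h := Measure.addHaar_submodule (volume : Measure (Fin m → ℝ))
    (LinearMap.ker ((LinearMap.proj i : (Fin m → ℝ) →ₗ[ℝ] ℝ) - LinearMap.proj j)) ?_
  · convert h using 2
    ext u
    simp [sub_eq_zero]
  · intro htop
    have h1 : (Pi.single i 1 : Fin m → ℝ) ∈
        LinearMap.ker ((LinearMap.proj i : (Fin m → ℝ) →ₗ[ℝ] ℝ) - LinearMap.proj j) :=
      htop ▸ Submodule.mem_top
    simp [hij.symm] at h1

/-- Integration over the cube by splitting off the largest coordinate: each coordinate is equally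
likely to be the largest, and the others then fill a smaller cube. -/
theorem lintegral_cube_succ {m : ℕ} {t : ℝ} {f : (Fin (m + 1) → ℝ) → ℝ≥0∞}
    {g : ℝ → (Fin m → ℝ) → ℝ≥0∞} (hg : Measurable (Function.uncurry g))
    (h : ∀ i : Fin (m + 1), ∀ s ∈ Ioo 0 t, ∀ v ∈ univ.pi fun _ : Fin m => Ioo 0 s,
      f (i.insertNth s v) = g s v) :
    ∫⁻ u in univ.pi fun _ => Ioo 0 t, f u =
      (m + 1) * ∫⁻ s in Ioo 0 t, ∫⁻ v in univ.pi fun _ => Ioo 0 s, g s v := by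
  let B : Fin (m + 1) → Set (Fin (m + 1) → ℝ) := fun i =>
    {u | u i ∈ Ioo 0 t ∧ ∀ j, u (i.succAbove j) ∈ Ioo 0 (u i)}
  let T : Set (ℝ × (Fin m → ℝ)) := {p | p.1 ∈ Ioo 0 t ∧ ∀ j, p.2 j ∈ Ioo 0 p.1}
  have hT : MeasurableSet T := by
    refine (measurable_fst measurableSet_Ioo).inter (MeasurableSet.congr
      (s := ⋂ j, {p : ℝ × (Fin m → ℝ) | 0 < p.2 j} ∩ {p | p.2 j < p.1})
      (MeasurableSet.iInter fun j => ?_) ?_)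
    · exact (measurableSet_lt measurable_const ((measurable_pi_apply j).comp measurable_snd)).inter
        (measurableSet_lt ((measurable_pi_apply j).comp measurable_snd) measurable_fst)
    · ext p; simp [mem_iInter]; rfl
  have hBT : ∀ i, B i = MeasurableEquiv.piFinSuccAbove (fun _ => ℝ) i ⁻¹' T := fun i => rfl
  have hBm : ∀ i, MeasurableSet (B i) := fun i =>
    hBT i ▸ (MeasurableEquiv.piFinSuccAbove (fun _ => ℝ) i).measurable hT
  have hdisj : Pairwise (Function.onFun Disjoint B) := by
    intro i j hij
    refine Set.disjoint_left.2 fun u hi hj => ?_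
    obtain ⟨a, ha⟩ := Fin.exists_succAbove_eq hij.symm
    obtain ⟨b, hb⟩ := Fin.exists_succAbove_eq hij
    have h1 := (hi.2 a).2
    have h2 := (hj.2 b).2
    rw [ha] at h1
    rw [hb] at h2
    exact lt_asymm h1 h2
  have hae : (univ.pi fun _ => Ioo 0 t : Set (Fin (m + 1) → ℝ)) =ᵐ[volume] ⋃ i, B i := by
    have hne : ∀ᵐ u : Fin (m + 1) → ℝ, ∀ i j, i ≠ j → u i ≠ u j := by
      refine ae_all_iff.2 fun i => ae_all_iff.2 fun j => ?_
      by_cases hij : i = j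
      · exact Filter.Eventually.of_forall fun u h => absurd hij h
      · have : ∀ᵐ u : Fin (m + 1) → ℝ, u i ≠ u j := by
          simpa [ae_iff] using volume_setOf_apply_eq_apply hij
        filter_upwards [this] with u hu _ using hu
    filter_upwards [hne] with u hu
    apply propext
    change u ∈ univ.pi (fun _ => Ioo 0 t) ↔ u ∈ ⋃ i, B i
    rw [mem_iUnion]
    constructor
    · intro h1
      obtain ⟨i, -, hi⟩ := Finset.exists_max_image Finset.univ u Finset.univ_nonempty
      refine ⟨i, h1 i trivial, fun j => ⟨(h1 _ trivial).1, ?_⟩⟩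
      exact lt_of_le_of_ne (hi _ (Finset.mem_univ _)) (hu _ _ (Fin.succAbove_ne i j))
    · rintro ⟨i, h1, h2⟩ j -
      by_cases hj : j = i
      · exact hj ▸ h1
      · obtain ⟨a, ha⟩ := Fin.exists_succAbove_eq hj
        have := h2 a
        rw [ha] at this
        exact ⟨this.1, this.2.trans h1.2⟩
  have hpiece : ∀ i, ∫⁻ u in B i, f u =
      ∫⁻ s in Ioo 0 t, ∫⁻ v in univ.pi fun _ => Ioo 0 s, g s v := by
    intro i
    have hp := volume_preserving_piFinSuccAbove (fun _ : Fin (m + 1) => ℝ) i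
    have e1 : ∫⁻ u in B i, f u = ∫⁻ u in MeasurableEquiv.piFinSuccAbove (fun _ => ℝ) i ⁻¹' T,
        Function.uncurry g (MeasurableEquiv.piFinSuccAbove (fun _ => ℝ) i u) := by
      rw [← hBT]
      refine setLIntegral_congr_fun (hBm i) fun u hu => ?_
      have := h i (u i) hu.1 (fun j => u (i.succAbove j)) (fun j _ => hu.2 j)
      rw [show (i.insertNth (u i) fun j => u (i.succAbove j)) = u from
        Fin.insertNth_self_removeNth i u] at this
      exact this
    rw [e1, hp.setLIntegral_comp_preimage_emb (MeasurableEquiv.measurableEmbedding _),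
      ← lintegral_indicator hT, Measure.volume_eq_prod, lintegral_prod _
        (hg.indicator hT).aemeasurable, ← lintegral_indicator measurableSet_Ioo]
    refine lintegral_congr fun s => ?_
    by_cases hs : s ∈ Ioo 0 t
    · rw [indicator_of_mem hs, ← lintegral_indicator (measurableSet_cube m s)]
      refine lintegral_congr fun v => ?_
      by_cases hv : v ∈ univ.pi fun _ : Fin m => Ioo 0 s
      · rw [indicator_of_mem hv, indicator_of_mem (show (s, v) ∈ T from
          ⟨hs, fun j => hv j trivial⟩)]
        rfl
      · rw [indicator_of_notMem hv, indicator_of_notMem]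
        exact fun h' => hv fun j _ => h'.2 j
    · rw [indicator_of_notMem hs]
      rw [← lintegral_zero (μ := (volume : Measure (Fin m → ℝ)))]
      refine lintegral_congr fun v => ?_
      rw [indicator_of_notMem]
      exact fun h' => hs h'.1
  rw [setLIntegral_congr hae, lintegral_iUnion hBm hdisj, tsum_fintype,
    Finset.sum_congr rfl fun i _ => hpiece i]
  simp

theorem lintegral_oppositeTime_succ {m : ℕ} (t : ℝ) {η : ℝ → ℝ≥0∞} (hη : Measurable η) :
    ∫⁻ u in univ.pi fun _ : Fin (m + 1) => Ioo 0 t, η (oppositeTime u t) =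
      (m + 1) * ∫⁻ s in Ioo 0 t, ∫⁻ v in univ.pi fun _ : Fin m => Ioo 0 s,
        η (s - oppositeTime v s) := by
  refine lintegral_cube_succ (f := fun u => η (oppositeTime u t))
    (g := fun s v => η (s - oppositeTime v s)) ?_ fun i s hs v hv => ?_
  · exact hη.comp (measurable_fst.sub (measurable_oppositeTime measurable_snd measurable_fst))
  · rw [oppositeTime_insertNth i hs.1.le hs.2.le fun j => (hv j trivial).2]

/-- The Dirichlet weight `x ^ a / a! * y ^ b / b!`. -/
noncomputable def dirichletWeight (a b : ℕ) (x y : ℝ) : ℝ := x ^ a / a ! * (y ^ b / b !)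

theorem continuous_dirichletWeight (a b : ℕ) :
    Continuous (Function.uncurry (dirichletWeight a b)) := by
  unfold dirichletWeight Function.uncurry
  fun_prop

theorem lintegral_dirichletWeight_sub (a b : ℕ) {y t : ℝ} (hy : 0 ≤ y) (hyt : y ≤ t) :
    ∫⁻ s in Ioo y t, ENNReal.ofReal (dirichletWeight a b (s - y) y) =
      ENNReal.ofReal (dirichletWeight b (a + 1) y (t - y)) := by
  have hc : Continuous fun s : ℝ => dirichletWeight a b (s - y) y := by
    unfold dirichletWeight; fun_prop
  rw [restrict_Ioo_eq_restrict_Ioc, ← ofReal_integral_eq_lintegral_ofReal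
    (hc.integrableOn_Ioc) ?_, ← intervalIntegral.integral_of_le hyt]
  · congr 1
    unfold dirichletWeight
    rw [intervalIntegral.integral_mul_const, intervalIntegral.integral_div,
      intervalIntegral.integral_comp_sub_right (fun s => s ^ a), integral_pow]
    rw [sub_self, zero_pow a.succ_ne_zero, Nat.factorial_succ]
    push_cast
    field_simp
    ring
  · refine (ae_restrict_iff' measurableSet_Ioc).2 (Filter.Eventually.of_forall fun s hs => ?_)
    have : 0 ≤ s - y := by linarith [hs.1]
    unfold dirichletWeight
    simp only [Pi.zero_apply]
    positivity

/-- One more reversal: if `x` has weight `(a, b)` on `(0, s)`, then integrating the law of `s - x`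
over the last reversal time `s ∈ (0, t)` gives the weight `(b, a + 1)` on `(0, t)`. -/
theorem lintegral_lintegral_dirichletWeight (a b : ℕ) (t : ℝ) {η : ℝ → ℝ≥0∞}
    (hη : Measurable η) :
    ∫⁻ s in Ioo 0 t, ∫⁻ x in Ioo 0 s, η (s - x) * ENNReal.ofReal (dirichletWeight a b x (s - x)) =
      ∫⁻ y in Ioo 0 t, η y * ENNReal.ofReal (dirichletWeight b (a + 1) y (t - y)) := by
  let F : ℝ → ℝ → ℝ≥0∞ := fun s y => (Ioi y).indicator
    (fun s => η y * ENNReal.ofReal (dirichletWeight a b (s - y) y)) s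
  have hF : Measurable (Function.uncurry F) := by
    have hw : Measurable fun p : ℝ × ℝ => dirichletWeight a b (p.1 - p.2) p.2 :=
      (continuous_dirichletWeight a b).measurable.comp
        ((measurable_fst.sub measurable_snd).prodMk measurable_snd)
    exact ((hη.comp measurable_snd).mul hw.ennreal_ofReal).indicator
      (s := {p : ℝ × ℝ | p.2 < p.1}) (measurableSet_lt measurable_snd measurable_fst)
  have h1 : ∀ s ∈ Ioo 0 t, ∫⁻ x in Ioo 0 s,
      η (s - x) * ENNReal.ofReal (dirichletWeight a b x (s - x)) = ∫⁻ y in Ioo 0 t, F s y := by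
    intro s hs
    have e1 : ∫⁻ x in Ioo 0 s, η (s - x) * ENNReal.ofReal (dirichletWeight a b x (s - x)) =
        ∫⁻ y in Ioo 0 s, η y * ENNReal.ofReal (dirichletWeight a b (s - y) y) := by
      rw [← lintegral_indicator measurableSet_Ioo, ← lintegral_indicator measurableSet_Ioo,
        ← lintegral_sub_left_eq_self _ s]
      refine lintegral_congr fun x => ?_
      by_cases hx : x ∈ Ioo 0 s
      · have hx' : s - x ∈ Ioo 0 s := ⟨by linarith [hx.2], by linarith [hx.1]⟩
        simp [indicator_of_mem hx, indicator_of_mem hx']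
      · have hx' : s - x ∉ Ioo 0 s := fun h => hx ⟨by linarith [h.2], by linarith [h.1]⟩
        simp [indicator_of_notMem hx, indicator_of_notMem hx']
    rw [e1, ← lintegral_indicator measurableSet_Ioo, ← lintegral_indicator measurableSet_Ioo]
    refine lintegral_congr fun y => ?_
    by_cases hy : y ∈ Ioo 0 s
    · rw [indicator_of_mem hy, indicator_of_mem (show y ∈ Ioo 0 t from ⟨hy.1, hy.2.trans hs.2⟩),
        show F s y = _ from indicator_of_mem (show s ∈ Ioi y from hy.2) _]
    · rw [indicator_of_notMem hy]
      by_cases hy' : y ∈ Ioo 0 t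
      · rw [indicator_of_mem hy', show F s y = 0 from
          indicator_of_notMem (fun h : s ∈ Ioi y => hy ⟨hy'.1, h⟩) _]
      · rw [indicator_of_notMem hy']
  rw [setLIntegral_congr_fun measurableSet_Ioo h1, lintegral_lintegral_swap hF.aemeasurable]
  refine setLIntegral_congr_fun measurableSet_Ioo fun y hy => ?_
  have h2 : ∀ s ∈ Ioo 0 t, F s y = (Ioi y).indicator
    (fun s => η y * ENNReal.ofReal (dirichletWeight a b (s - y) y)) s := fun s _ => rfl
  have hw : Measurable fun s => ENNReal.ofReal (dirichletWeight a b (s - y) y) :=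
    ((continuous_dirichletWeight a b).measurable.comp
        ((measurable_id.sub_const y).prodMk measurable_const)).ennreal_ofReal
  rw [setLIntegral_congr_fun measurableSet_Ioo h2, setLIntegral_indicator measurableSet_Ioi,
    show Ioi y ∩ Ioo 0 t = Ioo y t by
      ext s; simp only [mem_inter_iff, mem_Ioi, mem_Ioo]
      exact ⟨fun h => ⟨h.1, h.2.2⟩, fun h => ⟨h.1, hy.1.trans h.1, h.2⟩⟩,
    lintegral_const_mul _ hw, lintegral_dirichletWeight_sub a b hy.1.le hy.2.le]

/-- Adding a point turns the weight `(a, b)` of the opposite time into `(b, a + 1)`: what was the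
time along the final direction becomes the opposite time. -/
theorem lintegral_oppositeTime_step {m a b : ℕ}
    (h : ∀ t, 0 < t → ∀ η : ℝ → ℝ≥0∞, Measurable η →
      ∫⁻ u in univ.pi fun _ : Fin m => Ioo 0 t, η (oppositeTime u t) =
        m ! * ∫⁻ x in Ioo 0 t, η x * ENNReal.ofReal (dirichletWeight a b x (t - x)))
    (t : ℝ) {η : ℝ → ℝ≥0∞} (hη : Measurable η) :
    ∫⁻ u in univ.pi fun _ : Fin (m + 1) => Ioo 0 t, η (oppositeTime u t) =
      (m + 1)! * ∫⁻ x in Ioo 0 t, η x * ENNReal.ofReal (dirichletWeight b (a + 1) x (t - x)) := by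
  rw [lintegral_oppositeTime_succ t hη, ← lintegral_lintegral_dirichletWeight a b t hη,
    setLIntegral_congr_fun measurableSet_Ioo (fun s hs =>
      h s hs.1 (fun x => η (s - x)) (hη.comp (measurable_const.sub measurable_id))),
    lintegral_const_mul' _ _ (by simp), ← mul_assoc, Nat.factorial_succ]
  push_cast
  rfl

theorem lintegral_oppositeTime_one (t : ℝ) {η : ℝ → ℝ≥0∞} (hη : Measurable η) :
    ∫⁻ u in univ.pi fun _ : Fin 1 => Ioo 0 t, η (oppositeTime u t) = ∫⁻ x in Ioo 0 t, η x := by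
  rw [lintegral_oppositeTime_succ t hη]
  simp only [Nat.cast_zero, zero_add, one_mul]
  refine setLIntegral_congr_fun measurableSet_Ioo fun s hs => ?_
  have : (univ.pi fun _ : Fin 0 => Ioo 0 s) = univ := by ext; simp
  have h0 : ∀ v : Fin 0 → ℝ, oppositeTime v s = 0 := fun v => by
    simp [oppositeTime, signIntegral, pointCount]
  rw [this, Measure.restrict_univ]
  simp [h0, volume_pi]

/-- With an odd number `2 * k + 1` of uniform points, the time spent moving against the final
direction is a sum of `k + 1` of the `2 * k + 2` spacings, with the `Beta (k + 1, k + 1)` law. -/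
theorem lintegral_oppositeTime_odd (k : ℕ) : ∀ t, 0 < t → ∀ η : ℝ → ℝ≥0∞, Measurable η →
    ∫⁻ u in univ.pi fun _ : Fin (2 * k + 1) => Ioo 0 t, η (oppositeTime u t) =
      (2 * k + 1)! * ∫⁻ x in Ioo 0 t, η x * ENNReal.ofReal (dirichletWeight k k x (t - x)) := by
  induction k with
  | zero =>
    intro t _ η hη
    simpa [dirichletWeight] using lintegral_oppositeTime_one t hη
  | succ k ih =>
    intro t _ η hη
    exact lintegral_oppositeTime_step
      (fun s _ θ hθ => lintegral_oppositeTime_step ih s hθ) t hη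

/-! ### First passage over a level -/

/-- `τ` is the time at which `signIntegral x` first passes above the level `b`: it has not
been above `b` so far, is at `b`, and moves upwards. For a right-continuous `x` these conditions
determine `τ`, and they only involve `x` on `[0, τ]`. -/
structure IsFirstPassage (x : ℝ → ℕ) (b τ : ℝ) : Prop where
  nonneg : 0 ≤ τ
  le : ∀ s ∈ Icc 0 τ, signIntegral x s ≤ b
  eq : signIntegral x τ = b
  even : Even (x τ)

theorem IsFirstPassage.congr {x y : ℝ → ℕ} {b τ : ℝ} (h : IsFirstPassage x b τ)
    (hxy : ∀ s ∈ Icc 0 τ, x s = y s) : IsFirstPassage y b τ := by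
  have hI : ∀ s ∈ Icc 0 τ, signIntegral x s = signIntegral y s := fun s hs =>
    signIntegral_congr hs.1 fun r hr => hxy r ⟨hr.1, hr.2.le.trans hs.2⟩
  have hτ : τ ∈ Icc 0 τ := right_mem_Icc.2 h.nonneg
  exact ⟨h.nonneg, fun s hs => hI s hs ▸ h.le s hs, hI τ hτ ▸ h.eq, hxy τ hτ ▸ h.even⟩

theorem exists_forall_Ico_eq {x : ℝ → ℕ} {τ : ℝ} (hc : ContinuousWithinAt x (Ici τ) τ) :
    ∃ δ > 0, ∀ r ∈ Ico τ (τ + δ), x r = x τ := by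
  have h : ∀ᶠ s in nhdsWithin τ (Ici τ), x s = x τ :=
    hc (mem_nhds_discrete.2 rfl : {x τ} ∈ nhds (x τ))
  obtain ⟨u, hu, hs⟩ := (mem_nhdsGE_iff_exists_Ico_subset (a := τ)).1 h
  exact ⟨u - τ, sub_pos.2 hu, fun r hr => hs ⟨hr.1, by simpa using hr.2⟩⟩

theorem signIntegral_eq_add_of_forall_Ico {x : ℝ → ℕ} (hx : Measurable x) {τ δ s : ℝ}
    (h : ∀ r ∈ Ico τ (τ + δ), x r = x τ) (hs : s ∈ Ico τ (τ + δ)) :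
    signIntegral x s = signIntegral x τ + (-1) ^ x τ * (s - τ) := by
  have h1 := signIntegral_sub hx τ s
  rw [intervalIntegral.integral_congr (g := fun _ => (-1 : ℝ) ^ x τ)] at h1
  · rw [intervalIntegral.integral_const, smul_eq_mul] at h1
    linarith
  · intro r hr
    rw [uIcc_of_le hs.1] at hr
    simp only
    rw [h r ⟨hr.1, hr.2.trans_lt hs.2⟩]

theorem IsFirstPassage.exists_lt {x : ℝ → ℕ} {b τ : ℝ} (h : IsFirstPassage x b τ)
    (hx : Measurable x) (hc : ContinuousWithinAt x (Ici τ) τ) {t : ℝ} (ht : τ < t) :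
    ∃ s ∈ Ioo τ t, b < signIntegral x s := by
  obtain ⟨δ, hδ, hδx⟩ := exists_forall_Ico_eq hc
  obtain ⟨s, hs1, hs2⟩ := exists_between (lt_min ht (by linarith : τ < τ + δ))
  refine ⟨s, ⟨hs1, hs2.trans_le (min_le_left _ _)⟩, ?_⟩
  rw [signIntegral_eq_add_of_forall_Ico hx hδx ⟨hs1.le, hs2.trans_le (min_le_right _ _)⟩, h.eq,
    h.even.neg_one_pow]
  linarith

theorem IsFirstPassage.unique {x : ℝ → ℕ} {b τ σ : ℝ} (hx : Measurable x)
    (hc : ∀ r, ContinuousWithinAt x (Ici r) r) (h : IsFirstPassage x b τ)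
    (h' : IsFirstPassage x b σ) : τ = σ := by
  have key : ∀ {τ σ : ℝ}, IsFirstPassage x b τ → IsFirstPassage x b σ → σ ≤ τ := by
    intro τ σ h h'
    by_contra! hlt
    obtain ⟨s, hs, hb⟩ := h.exists_lt hx (hc τ) hlt
    exact absurd (h'.le s ⟨h.nonneg.trans hs.1.le, hs.2.le⟩) (not_le.2 hb)
  exact le_antisymm (key h' h) (key h h')

open Classical in
/-- The infimum of the rational times in `[0, t]` at which `signIntegral x` is above `b`, and `t`
if there is none. -/
noncomputable def passageTime (x : ℝ → ℕ) (b t : ℝ) : ℝ :=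
  ⨅ q : ℚ, if (0 : ℝ) ≤ q ∧ (q : ℝ) ≤ t ∧ b < signIntegral x q then (q : ℝ) else t

theorem isFirstPassage_passageTime {x : ℝ → ℕ} (hx : Measurable x)
    (hc : ∀ r, ContinuousWithinAt x (Ici r) r) {b t : ℝ} (hb : 0 ≤ b) (ht : 0 ≤ t)
    (hp : b < signPeak x t) :
    IsFirstPassage x b (passageTime x b t) ∧ passageTime x b t < t := by
  classical
  set τ := passageTime x b t with hτ
  have hcont := continuous_signIntegral hx
  let f : ℚ → ℝ := fun q => if (0 : ℝ) ≤ q ∧ (q : ℝ) ≤ t ∧ b < signIntegral x q then (q : ℝ) else t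
  have hf0 : ∀ q, 0 ≤ f q := by
    intro q
    simp only [f]
    split_ifs with h
    exacts [h.1, ht]
  have hτf : τ = ⨅ q, f q := by
    simp only [hτ, passageTime, f]
  have hbdd : BddBelow (range f) := ⟨0, by rintro _ ⟨q, rfl⟩; exact hf0 q⟩
  have hτ0 : 0 ≤ τ := hτf ▸ le_ciInf hf0
  -- By continuity, a time `s` above `b` is followed closely by rational times above `b`.
  have hle : ∀ s r, 0 ≤ s → s < r → r ≤ t → b < signIntegral x s → τ < r := by
    intro s r hs hsr hrt hbs
    have hev : ∀ᶠ v in nhds s, b < signIntegral x v ∧ v < r :=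
      (hcont.continuousAt.eventually (lt_mem_nhds hbs)).and (gt_mem_nhds hsr)
    obtain ⟨l, u, hlu, hsub⟩ := mem_nhds_iff_exists_Ioo_subset.1 hev
    obtain ⟨q, hq1, hq2⟩ := exists_rat_btwn hlu.2
    have hq := hsub ⟨hlu.1.trans hq1, hq2⟩
    have hfq : f q = q := if_pos ⟨hs.trans hq1.le, (hq.2.le.trans hrt), hq.1⟩
    calc τ ≤ f q := hτf ▸ ciInf_le hbdd q
      _ = q := hfq
      _ < r := hq.2
  have hlt : ∀ s, 0 ≤ s → s < τ → s < t → signIntegral x s ≤ b := by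
    intro s hs hsτ hst
    by_contra! hbs
    exact lt_irrefl _ ((hle s (min τ t) hs (lt_min hsτ hst) (min_le_right _ _) hbs).trans_le
      (min_le_left _ _))
  have hτt : τ < t := by
    obtain ⟨s, hs, hbs⟩ := (lt_signPeak_iff hx ht).1 hp
    have hs0 : 0 < s := by
      rcases hs.1.eq_or_lt with h | h
      · rw [← h, signIntegral_zero] at hbs
        exact absurd hbs (not_lt.2 hb)
      · exact h
    have hev : ∀ᶠ v in nhds s, b < signIntegral x v ∧ 0 < v :=
      (hcont.continuousAt.eventually (lt_mem_nhds hbs)).and (lt_mem_nhds hs0)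
    obtain ⟨l, u, hlu, hsub⟩ := mem_nhds_iff_exists_Ioo_subset.1 hev
    obtain ⟨v, hv1, hv2⟩ := exists_between hlu.1
    have hv := hsub ⟨hv1, hv2.trans hlu.2⟩
    exact hle v t hv.2.le (hv2.trans_le hs.2) le_rfl hv.1
  have hleτ : signIntegral x τ ≤ b := by
    rcases hτ0.eq_or_lt with h | h
    · rw [← h, signIntegral_zero]; exact hb
    · refine le_of_tendsto (hcont.continuousWithinAt (s := Iio τ) (x := τ)) ?_
      have h0 : ∀ᶠ s in nhdsWithin τ (Iio τ), 0 < s :=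
        nhdsWithin_le_nhds (lt_mem_nhds h)
      filter_upwards [h0, self_mem_nhdsWithin] with s hs1 hs2
      exact hlt s hs1.le hs2 (lt_trans hs2 hτt)
  have hex : ∀ r, τ < r → ∃ s ∈ Ico τ r, b < signIntegral x s := by
    intro r hr
    have h1 : ⨅ q, f q < min t r := hτf ▸ lt_min hτt hr
    obtain ⟨q, hq⟩ := exists_lt_of_ciInf_lt h1
    have hcond : (0 : ℝ) ≤ q ∧ (q : ℝ) ≤ t ∧ b < signIntegral x q := by
      by_contra hn
      have : f q = t := if_neg hn
      rw [this] at hq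
      exact lt_irrefl _ (hq.trans_le (min_le_left _ _))
    have hfq : f q = q := if_pos hcond
    rw [hfq] at hq
    exact ⟨q, ⟨by rw [← hfq, hτf]; exact ciInf_le hbdd q, hq.trans_le (min_le_right _ _)⟩,
      hcond.2.2⟩
  obtain ⟨δ, hδ, hδx⟩ := exists_forall_Ico_eq (hc τ)
  obtain ⟨s, hs, hbs⟩ := hex (τ + δ) (by linarith)
  have heq := signIntegral_eq_add_of_forall_Ico hx hδx hs
  have heven : Even (x τ) := by
    by_contra hodd
    rw [Nat.not_even_iff_odd] at hodd
    rw [hodd.neg_one_pow] at heq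
    linarith [hs.1]
  refine ⟨⟨hτ0, fun s hs => ?_, le_antisymm hleτ ?_, heven⟩, hτt⟩
  · rcases hs.2.eq_or_lt with h | h
    · rw [h]; exact hleτ
    · exact hlt s hs.1 h (h.trans hτt)
  · -- The path is above `b` at times arbitrarily close to `τ` on the right.
    by_contra! hlt'
    have hev : ∀ᶠ v in nhds τ, signIntegral x v < b :=
      hcont.continuousAt.eventually (gt_mem_nhds hlt')
    obtain ⟨l, u, hlu, hsub⟩ := mem_nhds_iff_exists_Ioo_subset.1 hev
    obtain ⟨v, hv, hbv⟩ := hex u hlu.2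
    exact lt_asymm hbv (hsub ⟨hlu.1.trans_le hv.1, hv.2⟩)

theorem IsFirstPassage.passageTime_eq {x : ℝ → ℕ} (hx : Measurable x)
    (hc : ∀ r, ContinuousWithinAt x (Ici r) r) {b t τ : ℝ} (hb : 0 ≤ b)
    (h : IsFirstPassage x b τ) (ht : τ < t) : passageTime x b t = τ := by
  have ht0 := h.nonneg.trans ht.le
  obtain ⟨s, hs, hbs⟩ := h.exists_lt hx (hc τ) ht
  exact (isFirstPassage_passageTime hx hc hb ht0 ((lt_signPeak_iff hx ht0).2
    ⟨s, ⟨h.nonneg.trans hs.1.le, hs.2.le⟩, hbs⟩)).1.unique hx hc h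

theorem exists_lt_of_passageTime_lt {x : ℝ → ℕ} {b t : ℝ} (h : passageTime x b t < t) :
    ∃ s ∈ Icc 0 t, b < signIntegral x s := by
  obtain ⟨q, hq⟩ := exists_lt_of_ciInf_lt h
  split_ifs at hq with hc
  · exact ⟨q, ⟨hc.1, hc.2.1⟩, hc.2.2⟩
  · exact absurd hq (lt_irrefl t)

theorem measurable_passageTime {ι : Type*} (A : Finset ι) (b t : ℝ) :
    Measurable fun u : ι → ℝ => passageTime (pointCount A u) b t := by
  classical
  unfold passageTime
  refine Measurable.iInf fun q => Measurable.ite ?_ measurable_const measurable_const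
  refine (MeasurableSet.const _).inter ((MeasurableSet.const _).inter ?_)
  exact measurableSet_lt measurable_const
    (measurable_signIntegral_pointCount A measurable_pi_apply measurable_const)

/-! ### Reversing the order of the points after the first passage -/

/-- Reflecting some of the coordinates about a centre that depends on the others only preserves
the volume. -/
theorem measurePreserving_reflect {ι : Type*} [Fintype ι] (p : ι → Prop) [DecidablePred p]
    {f : (ι → ℝ) → ℝ} (hf : Measurable f)
    (hp : ∀ u v : ι → ℝ, (∀ i, p i → u i = v i) → f u = f v) :
    MeasurePreserving (fun (u : ι → ℝ) i => if p i then u i else f u - u i) volume volume := by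
  let e := MeasurableEquiv.piEquivPiSubtypeProd (fun _ : ι => ℝ) p
  have he : MeasurePreserving e volume volume :=
    volume_preserving_piEquivPiSubtypeProd (fun _ : ι => ℝ) p
  let F : ({i // p i} → ℝ) → ℝ := fun v => f (e.symm (v, 0))
  have hF : Measurable F := hf.comp (e.symm.measurable.comp (measurable_id.prodMk measurable_const))
  let g : ({i // p i} → ℝ) → ({i // ¬ p i} → ℝ) → ({i // ¬ p i} → ℝ) := fun v w i => F v - w i
  have hg : Measurable (Function.uncurry g) :=
    measurable_pi_lambda _ fun i => (hF.comp measurable_fst).sub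
      ((measurable_pi_apply i).comp measurable_snd)
  have hmid : MeasurePreserving
      (fun q : ({i // p i} → ℝ) × ({i // ¬ p i} → ℝ) => (q.1, g q.1 q.2)) volume volume := by
    refine (MeasurePreserving.id volume).skew_product hg (Filter.Eventually.of_forall fun v => ?_)
    exact (volume_preserving_pi fun i : {i // ¬ p i} =>
      Measure.measurePreserving_sub_left volume (F v)).map_eq
  have h := (he.symm e).comp (hmid.comp he)
  refine Eq.subst (motive := fun F => MeasurePreserving F volume volume) ?_ h
  funext u i
  have hFu : F (e u).1 = f u := by
    refine hp _ _ fun j hj => ?_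
    simp [e, MeasurableEquiv.piEquivPiSubtypeProd, Equiv.piEquivPiSubtypeProd, hj]
  have : (e.symm ((e u).1, g (e u).1 (e u).2)) i = if p i then u i else F (e u).1 - u i := by
    simp only [e, g, MeasurableEquiv.piEquivPiSubtypeProd, Equiv.piEquivPiSubtypeProd]
    by_cases hi : p i <;> simp [hi]
  rw [Function.comp_apply, Function.comp_apply, this, hFu]

/-- The points with index outside `A` reflected in the interval between `t` and the first passage
time over `b` of the path made by the points with index in `A`. -/
noncomputable def reflectPoints {m : ℕ} (A : Finset (Fin m)) (b t : ℝ) (u : Fin m → ℝ)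
    (i : Fin m) : ℝ :=
  if i ∈ A then u i else t + passageTime (pointCount A u) b t - u i

/-- The configurations of points in `(0, t)` whose path passes above `b` before `t`, the points up
to that time being exactly those with index in `A`. -/
def passageSet {m : ℕ} (A : Finset (Fin m)) (b t : ℝ) : Set (Fin m → ℝ) :=
  {u | (∀ i, u i ∈ Ioo 0 t) ∧ passageTime (pointCount A u) b t < t ∧
    ∀ i, i ∈ A ↔ u i ≤ passageTime (pointCount A u) b t}

theorem isFirstPassage_of_mem_passageSet {m : ℕ} {A : Finset (Fin m)} {b t : ℝ} (hb : 0 ≤ b)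
    {u : Fin m → ℝ} (hu : u ∈ passageSet A b t) :
    IsFirstPassage (pointCount A u) b (passageTime (pointCount A u) b t) := by
  obtain ⟨s, hs, hbs⟩ := exists_lt_of_passageTime_lt hu.2.1
  have ht : 0 ≤ t := hs.1.trans hs.2
  have hx := (monotone_pointCount A u).measurable
  exact (isFirstPassage_passageTime hx (continuousWithinAt_pointCount A u) hb ht
    ((lt_signPeak_iff hx ht).2 ⟨s, hs, hbs⟩)).1

theorem pointCount_congr {ι : Type*} {A : Finset ι} {u v : ι → ℝ} (h : ∀ i ∈ A, u i = v i) :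
    pointCount A u = pointCount A v := by
  funext r
  unfold pointCount
  rw [Finset.filter_congr fun i hi => by rw [h i hi]]

theorem pointCount_reflectPoints {m : ℕ} (A : Finset (Fin m)) (b t : ℝ) (u : Fin m → ℝ) :
    pointCount A (reflectPoints A b t u) = pointCount A u :=
  pointCount_congr fun _ hi => if_pos hi

theorem reflectPoints_reflectPoints {m : ℕ} (A : Finset (Fin m)) (b t : ℝ) (u : Fin m → ℝ) :
    reflectPoints A b t (reflectPoints A b t u) = u := by
  funext i
  rw [reflectPoints, pointCount_reflectPoints]
  by_cases hi : i ∈ A <;> simp [reflectPoints, hi]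

theorem measurePreserving_reflectPoints {m : ℕ} (A : Finset (Fin m)) (b t : ℝ) :
    MeasurePreserving (reflectPoints A b t) volume volume :=
  measurePreserving_reflect (· ∈ A) (f := fun u => t + passageTime (pointCount A u) b t)
    ((measurable_passageTime A b t).const_add t)
    fun u v h => by rw [pointCount_congr h]

theorem reflectPoints_mem_passageSet {m : ℕ} {A : Finset (Fin m)} {b t : ℝ} (hb : 0 ≤ b)
    {u : Fin m → ℝ} (hu : u ∈ passageSet A b t) : reflectPoints A b t u ∈ passageSet A b t := by
  have h0 := (isFirstPassage_of_mem_passageSet hb hu).nonneg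
  obtain ⟨h1, h3, h4⟩ := hu
  refine ⟨fun i => ?_, ?_⟩
  · by_cases hi : i ∈ A
    · simpa [reflectPoints, hi] using h1 i
    · have h5 : passageTime (pointCount A u) b t < u i := not_le.1 fun h => hi ((h4 i).2 h)
      simp only [reflectPoints, hi, if_false]
      exact ⟨by linarith [(h1 i).2], by linarith⟩
  · rw [pointCount_reflectPoints]
    refine ⟨h3, fun i => ?_⟩
    by_cases hi : i ∈ A
    · simpa [reflectPoints, hi] using (h4 i).1 hi
    · simp only [reflectPoints, hi, if_false, false_iff, not_le]
      linarith [(h1 i).2]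

theorem pointCount_univ_eq_of_le {m : ℕ} {A : Finset (Fin m)} {u : Fin m → ℝ} {τ : ℝ}
    (h : ∀ i, u i ≤ τ → i ∈ A) {r : ℝ} (hr : r ≤ τ) :
    pointCount Finset.univ u r = pointCount A u r := by
  unfold pointCount
  congr 1
  ext i
  simp only [Finset.mem_filter, Finset.mem_univ, true_and]
  exact ⟨fun hi => ⟨h i (hi.trans hr), hi⟩, fun hi => hi.2⟩

theorem pointCount_univ_eq_add {m : ℕ} (A : Finset (Fin m)) {u : Fin m → ℝ} {r : ℝ}
    (h : ∀ i ∈ A, u i ≤ r) :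
    pointCount Finset.univ u r = A.card + pointCount Aᶜ u r := by
  unfold pointCount
  rw [← Finset.card_filter_add_card_filter_not (s := Finset.univ.filter fun i => u i ≤ r)
    (fun i => i ∈ A)]
  congr 2
  · ext i
    simp only [Finset.mem_filter, Finset.mem_univ, true_and]
    exact ⟨fun hi => hi.2, fun hi => ⟨h i hi, hi⟩⟩
  · ext i
    simp only [Finset.mem_filter, Finset.mem_univ, true_and, Finset.mem_compl]
    exact and_comm

theorem isFirstPassage_univ_of_mem_passageSet {m : ℕ} {A : Finset (Fin m)} {b t : ℝ}
    (hb : 0 ≤ b) {u : Fin m → ℝ} (hu : u ∈ passageSet A b t) :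
    IsFirstPassage (pointCount Finset.univ u) b (passageTime (pointCount A u) b t) :=
  (isFirstPassage_of_mem_passageSet hb hu).congr fun _ hs =>
    (pointCount_univ_eq_of_le (fun i => (hu.2.2 i).2) hs.2).symm

/-- Reflection reverses the order of the intervals between reversals after the passage time. The
number of reversals before that time is even and the total is odd, so the path still starts
upwards and ends downwards there, and its displacement changes sign. -/
theorem signIntegral_reflectPoints {m : ℕ} (hm : Odd m) {A : Finset (Fin m)} {b t : ℝ}
    (hb : 0 ≤ b) {u : Fin m → ℝ} (hu : u ∈ passageSet A b t) :
    signIntegral (pointCount Finset.univ (reflectPoints A b t u)) t - b =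
      -(signIntegral (pointCount Finset.univ u) t - b) := by
  have hu' := reflectPoints_mem_passageSet hb hu
  have hp := isFirstPassage_univ_of_mem_passageSet hb hu
  have hp' := isFirstPassage_univ_of_mem_passageSet hb hu'
  rw [pointCount_reflectPoints] at hp'
  set v := reflectPoints A b t u with hv
  set τ := passageTime (pointCount A u) b t with hτ
  have hτt : τ < t := hu.2.1
  have hA : ∀ i, i ∈ A ↔ u i ≤ τ := hu.2.2
  have hA' : ∀ i, i ∈ A ↔ v i ≤ τ := by
    have := hu'.2.2
    rwa [pointCount_reflectPoints] at this
  have h1 := signIntegral_sub (monotone_pointCount Finset.univ u).measurable τ t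
  have h2 := signIntegral_sub (monotone_pointCount Finset.univ v).measurable τ t
  rw [hp.eq] at h1
  rw [hp'.eq] at h2
  rw [h1, h2]
  have heven : Even A.card := by
    have h3 := pointCount_univ_eq_add A (fun i hi => (hA i).1 hi)
    have h4 : pointCount Aᶜ u τ = 0 := by
      unfold pointCount
      rw [Finset.card_eq_zero, Finset.filter_eq_empty_iff]
      intro i hi h
      exact (Finset.mem_compl.1 hi) ((hA i).2 h)
    rw [h4, add_zero] at h3
    exact h3 ▸ hp.even
  -- Away from the reflected points, the two counts add up to an odd number.
  have hodd : ∀ r ∈ Ioc τ t, (∀ i, u i ≠ t + τ - r) →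
      (-1 : ℝ) ^ pointCount Finset.univ v r =
        -(-1 : ℝ) ^ pointCount Finset.univ u (t + τ - r) := by
    intro r hr hne
    have hsum : pointCount Aᶜ v r + pointCount Aᶜ u (t + τ - r) = Aᶜ.card := by
      unfold pointCount
      rw [← Finset.card_filter_add_card_filter_not (s := Aᶜ) (fun i => v i ≤ r)]
      congr 2
      refine Finset.filter_congr fun i hi => ?_
      have hvi : v i = t + τ - u i := if_neg (Finset.mem_compl.1 hi)
      rw [hvi, not_le]
      constructor
      · intro h
        have := lt_of_le_of_ne h (hne i)
        linarith
      · intro h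
        linarith
    have e1 := pointCount_univ_eq_add A (u := v) (r := r)
      (fun i hi => ((hA' i).1 hi).trans hr.1.le)
    have e2 := pointCount_univ_eq_add A (u := u) (r := t + τ - r)
      (fun i hi => ((hA i).1 hi).trans (by linarith [hr.2]))
    have e3 : A.card + Aᶜ.card = m := by simp
    have hO : Odd (pointCount Finset.univ v r + pointCount Finset.univ u (t + τ - r)) := by
      have : pointCount Finset.univ v r + pointCount Finset.univ u (t + τ - r) = A.card + m := by
        omega
      rw [this]
      exact heven.add_odd hm
    rcases Nat.even_or_odd (pointCount Finset.univ v r) with h | h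
    · have h' : Odd (pointCount Finset.univ u (t + τ - r)) := (Nat.odd_add'.1 hO).2 h
      rw [h.neg_one_pow, h'.neg_one_pow, neg_neg]
    · have h' : Even (pointCount Finset.univ u (t + τ - r)) := (Nat.odd_add.1 hO).1 h
      rw [h.neg_one_pow, h'.neg_one_pow]
  have h3 : ∫ r in τ..t, (-1 : ℝ) ^ pointCount Finset.univ v r =
      ∫ r in τ..t, -(-1 : ℝ) ^ pointCount Finset.univ u (t + τ - r) := by
    refine intervalIntegral.integral_congr_ae ?_
    have hae : ∀ᵐ r : ℝ, ∀ i, r ≠ t + τ - u i := ae_all_iff.2 fun i => Measure.ae_ne volume _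
    filter_upwards [hae] with r hr hr'
    rw [uIoc_of_le hτt.le] at hr'
    exact hodd r hr' fun i h => hr i (by linarith)
  rw [h3, intervalIntegral.integral_neg, intervalIntegral.integral_comp_sub_left
    (fun r => (-1 : ℝ) ^ pointCount Finset.univ u r)]
  congr 2
  · ring
  · ring

theorem measurableSet_passageSet {m : ℕ} (A : Finset (Fin m)) (b t : ℝ) :
    MeasurableSet (passageSet A b t) := by
  have hτ := measurable_passageTime A b t
  have heq : passageSet A b t = (⋂ i, {u | u i ∈ Ioo 0 t}) ∩
      ({u | passageTime (pointCount A u) b t < t} ∩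
        ⋂ i, {u | i ∈ A ↔ u i ≤ passageTime (pointCount A u) b t}) := by
    ext u
    simp only [passageSet, mem_inter_iff, mem_iInter, mem_ofPred_eq]
  rw [heq]
  refine (MeasurableSet.iInter fun i => measurable_pi_apply i measurableSet_Ioo).inter
    ((measurableSet_lt hτ measurable_const).inter (MeasurableSet.iInter fun i => ?_))
  by_cases hi : i ∈ A
  · simpa [hi] using measurableSet_le (measurable_pi_apply i) hτ
  · simpa [hi] using measurableSet_lt hτ (measurable_pi_apply i)

/-- The configurations whose path passes above `b` split according to which points come before
the passage time. -/
theorem setOf_lt_signPeak_eq_iUnion {m : ℕ} {b t : ℝ} (hb : 0 ≤ b) (ht : 0 ≤ t) :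
    {u : Fin m → ℝ | (∀ i, u i ∈ Ioo 0 t) ∧ b < signPeak (pointCount Finset.univ u) t} =
      ⋃ A : Finset (Fin m), passageSet A b t := by
  ext u
  have hx := fun A : Finset (Fin m) => (monotone_pointCount A u).measurable
  have hc := fun A : Finset (Fin m) => continuousWithinAt_pointCount A u
  rw [mem_iUnion]
  constructor
  · rintro ⟨hu, hp⟩
    obtain ⟨h1, h2⟩ := isFirstPassage_passageTime (hx _) (hc _) hb ht hp
    set τ := passageTime (pointCount Finset.univ u) b t
    refine ⟨Finset.univ.filter fun i => u i ≤ τ, hu, ?_⟩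
    have h3 : IsFirstPassage (pointCount (Finset.univ.filter fun i => u i ≤ τ) u) b τ :=
      h1.congr fun s hs => pointCount_univ_eq_of_le (fun i hi => by simpa using hi) hs.2
    rw [h3.passageTime_eq (hx _) (hc _) hb h2]
    exact ⟨h2, fun i => by simp⟩
  · rintro ⟨A, hu⟩
    have h1 := isFirstPassage_univ_of_mem_passageSet hb hu
    obtain ⟨s, hs, hbs⟩ := h1.exists_lt (hx _) (hc _ _) hu.2.1
    exact ⟨hu.1, (lt_signPeak_iff (hx _) ht).2 ⟨s, ⟨h1.nonneg.trans hs.1.le, hs.2.le⟩, hbs⟩⟩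

theorem pairwise_disjoint_passageSet {m : ℕ} {b t : ℝ} (hb : 0 ≤ b) :
    Pairwise (Function.onFun Disjoint fun A : Finset (Fin m) => passageSet A b t) := by
  intro A B hAB
  refine Set.disjoint_left.2 fun u hA hB => hAB ?_
  have h1 := isFirstPassage_univ_of_mem_passageSet hb hA
  have h2 := isFirstPassage_univ_of_mem_passageSet hb hB
  have h3 := h1.unique (monotone_pointCount _ u).measurable (continuousWithinAt_pointCount _ u) h2
  ext i
  rw [hA.2.2 i, hB.2.2 i, h3]

/-- The reflection principle for an odd number of uniform reversal points. -/
theorem uniformPoints_reflection {m : ℕ} (hm : Odd m) {b t : ℝ} (hb : 0 ≤ b) (ht : 0 ≤ t) :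
    uniformPoints m t {u | b < signPeak (pointCount Finset.univ u) t ∧
        signIntegral (pointCount Finset.univ u) t < b} =
      uniformPoints m t {u | b < signPeak (pointCount Finset.univ u) t ∧
        b < signIntegral (pointCount Finset.univ u) t} := by
  have hS : Measurable fun u : Fin m → ℝ => signIntegral (pointCount Finset.univ u) t :=
    measurable_signIntegral_pointCount _ measurable_pi_apply measurable_const
  have key : ∀ S : Set ℝ, MeasurableSet S →
      uniformPoints m t {u | b < signPeak (pointCount Finset.univ u) t ∧
        signIntegral (pointCount Finset.univ u) t ∈ S} =
      (volume (univ.pi fun _ : Fin m => Ioo 0 t))⁻¹ * ∑ A : Finset (Fin m),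
        volume (passageSet A b t ∩ {u | signIntegral (pointCount Finset.univ u) t ∈ S}) := by
    intro S hSm
    rw [uniformPoints, cond_apply (measurableSet_cube m t)]
    congr 1
    have : (univ.pi fun _ => Ioo 0 t) ∩ {u : Fin m → ℝ |
        b < signPeak (pointCount Finset.univ u) t ∧
          signIntegral (pointCount Finset.univ u) t ∈ S} =
        ⋃ A : Finset (Fin m), (passageSet A b t ∩
          {u | signIntegral (pointCount Finset.univ u) t ∈ S}) := by
      rw [← iUnion_inter, ← setOf_lt_signPeak_eq_iUnion hb ht]
      ext u
      simp only [mem_inter_iff, mem_pi, mem_univ, true_implies, mem_ofPred_eq, and_assoc]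
    rw [this, measure_iUnion, tsum_fintype]
    · intro A B hAB
      exact (pairwise_disjoint_passageSet hb hAB).mono inter_subset_left inter_subset_left
    · exact fun A => (measurableSet_passageSet A b t).inter (hS hSm)
  refine (key (Iio b) measurableSet_Iio).trans (Eq.trans ?_ (key (Ioi b) measurableSet_Ioi).symm)
  congr 1
  refine Finset.sum_congr rfl fun A _ => ?_
  refine Eq.trans (congrArg volume ?_) ((measurePreserving_reflectPoints A b t).measure_preimage
    ((measurableSet_passageSet A b t).inter (hS measurableSet_Ioi)).nullMeasurableSet)
  ext u
  have hflip : ∀ v ∈ passageSet A b t, (signIntegral (pointCount Finset.univ v) t < b ↔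
      b < signIntegral (pointCount Finset.univ (reflectPoints A b t v)) t) := by
    intro v hv
    have := signIntegral_reflectPoints hm hb hv
    constructor <;> intro h <;> linarith
  constructor
  · rintro ⟨h1, h2⟩
    exact ⟨reflectPoints_mem_passageSet hb h1, (hflip u h1).1 h2⟩
  · rintro ⟨h1, h2⟩
    have h3 := reflectPoints_mem_passageSet hb h1
    rw [reflectPoints_reflectPoints] at h3
    exact ⟨h3, (hflip u h3).2 h2⟩

/-! ### The laws of the endpoint and of the peak -/

theorem measurable_density (c t : ℝ) (k : ℕ) : Measurable (density c t k) := by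
  unfold density
  fun_prop

theorem density_two_mul_sub {c t : ℝ} (hc : 0 < c) (ht : 0 < t) (k : ℕ) (x : ℝ) :
    2 * c * density c t k (2 * c * x - c * t) =
      (t ^ (2 * k + 1))⁻¹ * ((2 * k + 1)! * dirichletWeight k k x (t - x)) := by
  have h1 : c ^ 2 * t ^ 2 - (2 * c * x - c * t) ^ 2 = (2 * c) ^ 2 * (x * (t - x)) := by ring
  unfold density dirichletWeight
  rw [h1, mul_pow ((2 * c) ^ 2), ← pow_mul, mul_pow x, mul_pow (2 * c) t]
  have h2 : (2 * c) ^ (2 * k + 1) = (2 * c) ^ (2 * k) * (2 * c) := pow_succ _ _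
  rw [h2]
  field_simp

theorem lintegral_comp_mul_sub {a : ℝ} (ha : 0 < a) (d : ℝ) {g : ℝ → ℝ≥0∞} (hg : Measurable g) :
    ∫⁻ y, g y = ∫⁻ x, ENNReal.ofReal a * g (a * x - d) := by
  have hm : Measurable fun y => g (y - d) := hg.comp (measurable_id.sub_const d)
  rw [lintegral_const_mul' _ _ ENNReal.ofReal_ne_top, ← lintegral_sub_right_eq_self g d]
  conv_lhs => rw [← Real.smul_map_volume_mul_left ha.ne']
  rw [lintegral_smul_measure, lintegral_map hm (measurable_const_mul a), abs_of_pos ha,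
    smul_eq_mul]

theorem map_mul_signIntegral_uniformPoints {c t : ℝ} (hc : 0 < c) (ht : 0 < t) (k : ℕ) :
    (uniformPoints (2 * k + 1) t).map
        (fun u => c * signIntegral (pointCount Finset.univ u) t) =
      (volume.restrict (Ioo (-(c * t)) (c * t))).withDensity
        (fun x => ENNReal.ofReal (density c t k x)) := by
  have hS : Measurable fun u : Fin (2 * k + 1) → ℝ =>
      c * signIntegral (pointCount Finset.univ u) t :=
    (measurable_signIntegral_pointCount _ measurable_pi_apply measurable_const).const_mul c
  have hopp : ∀ u : Fin (2 * k + 1) → ℝ, c * signIntegral (pointCount Finset.univ u) t =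
      2 * c * oppositeTime u t - c * t := by
    intro u
    rw [oppositeTime, (odd_two_mul_add_one k).neg_one_pow]
    ring
  ext B hB
  have hm : Measurable fun x : ℝ => 2 * c * x - c * t := by fun_prop
  have hd := (measurable_density c t k).ennreal_ofReal
  rw [Measure.map_apply hS hB, withDensity_apply _ hB, ← lintegral_indicator hB,
    ← lintegral_indicator measurableSet_Ioo,
    lintegral_comp_mul_sub (by positivity : 0 < 2 * c) (c * t)
      ((hd.indicator hB).indicator measurableSet_Ioo),
    ← lintegral_indicator_one (hS hB), uniformPoints, ProbabilityTheory.cond,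
    lintegral_smul_measure,
    volume_cube_Ioo _ ht.le]
  have h1 := lintegral_oppositeTime_odd k t ht
    (fun x => B.indicator 1 (2 * c * x - c * t)) ((measurable_one.indicator hB).comp hm)
  have h2 : ∀ u : Fin (2 * k + 1) → ℝ,
      ((fun u => c * signIntegral (pointCount Finset.univ u) t) ⁻¹' B).indicator
        (1 : (Fin (2 * k + 1) → ℝ) → ℝ≥0∞) u =
      B.indicator 1 (2 * c * oppositeTime u t - c * t) := by
    intro u
    rw [← hopp]
    rfl
  rw [lintegral_congr h2, h1, ← lintegral_const_mul' _ _ (by simp), smul_eq_mul,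
    ← lintegral_const_mul' _ _ (by simpa using pow_pos ht (2 * k + 1)),
    ← lintegral_indicator measurableSet_Ioo]
  refine lintegral_congr fun x => ?_
  have hiff : 2 * c * x - c * t ∈ Ioo (-(c * t)) (c * t) ↔ x ∈ Ioo 0 t := by
    simp only [mem_Ioo]
    constructor
    · rintro ⟨h1, h2⟩
      exact ⟨by nlinarith, by nlinarith⟩
    · rintro ⟨h1, h2⟩
      exact ⟨by nlinarith [mul_pos hc h1], by nlinarith [mul_lt_mul_of_pos_left h2 hc]⟩
  by_cases hx : x ∈ Ioo 0 t
  · rw [indicator_of_mem hx, indicator_of_mem (hiff.2 hx)]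
    by_cases hxB : 2 * c * x - c * t ∈ B
    · rw [indicator_of_mem hxB, indicator_of_mem hxB, Pi.one_apply, one_mul,
        ← ENNReal.ofReal_mul (by positivity), density_two_mul_sub hc ht,
        ENNReal.ofReal_mul (by positivity), ENNReal.ofReal_mul (by positivity),
        ENNReal.ofReal_natCast, ENNReal.ofReal_inv_of_pos (by positivity)]
    · rw [indicator_of_notMem hxB, indicator_of_notMem hxB]
      simp
  · rw [indicator_of_notMem hx, indicator_of_notMem (fun h => hx (hiff.1 h))]
    simp

theorem uniformPoints_signIntegral_eq {t : ℝ} (ht : 0 < t) (k : ℕ) (b : ℝ) :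
    uniformPoints (2 * k + 1) t {u | signIntegral (pointCount Finset.univ u) t = b} = 0 := by
  have hS : Measurable fun u : Fin (2 * k + 1) → ℝ =>
      1 * signIntegral (pointCount Finset.univ u) t :=
    (measurable_signIntegral_pointCount _ measurable_pi_apply measurable_const).const_mul 1
  have h := map_mul_signIntegral_uniformPoints one_pos ht k
  have h1 := congrArg (fun μ => μ {b}) h
  rw [Measure.map_apply hS (measurableSet_singleton b), (withDensity_absolutelyContinuous _ _)
    (measure_singleton b)] at h1
  simp only [one_mul] at h1
  exact h1

/-- The distribution tail of the peak is twice that of the endpoint, by the reflection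
principle. -/
theorem uniformPoints_lt_signPeak {t : ℝ} (ht : 0 < t) (k : ℕ) {b : ℝ} (hb : 0 ≤ b) :
    uniformPoints (2 * k + 1) t {u | b < signPeak (pointCount Finset.univ u) t} =
      2 * uniformPoints (2 * k + 1) t {u | b < signIntegral (pointCount Finset.univ u) t} := by
  have hS : Measurable fun u : Fin (2 * k + 1) → ℝ => signIntegral (pointCount Finset.univ u) t :=
    measurable_signIntegral_pointCount _ measurable_pi_apply measurable_const
  have hle : ∀ u : Fin (2 * k + 1) → ℝ, signIntegral (pointCount Finset.univ u) t ≤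
      signPeak (pointCount Finset.univ u) t := fun u =>
    signIntegral_le_signPeak (monotone_pointCount _ u).measurable (right_mem_Icc.2 ht.le)
  have hsub : {u : Fin (2 * k + 1) → ℝ | b < signPeak (pointCount Finset.univ u) t ∧
        b < signIntegral (pointCount Finset.univ u) t} =
      {u | b < signIntegral (pointCount Finset.univ u) t} := by
    ext u
    exact ⟨fun h => h.2, fun h => ⟨lt_of_lt_of_le h (hle u), h⟩⟩
  have hrefl := uniformPoints_reflection (odd_two_mul_add_one k) hb ht.le
  rw [hsub] at hrefl
  refine (measure_inter_add_sdiff _ (hS (measurableSet_Ioi (a := b)))).symm.trans ?_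
  rw [two_mul (uniformPoints _ _ _)]
  refine congrArg₂ (fun x y : ℝ≥0∞ => x + y) (congrArg _ ?_) ?_
  · ext u
    exact ⟨fun h => h.2, fun h => ⟨lt_of_lt_of_le h (hle u), h⟩⟩
  · rw [← hrefl]
    refine measure_congr ?_
    have h0 : ∀ᵐ u ∂uniformPoints (2 * k + 1) t,
        signIntegral (pointCount Finset.univ u) t ≠ b := by
      simpa [ae_iff] using uniformPoints_signIntegral_eq ht k b
    filter_upwards [h0] with u hu
    apply propext
    constructor
    · rintro ⟨h1, h2⟩
      exact ⟨h1, lt_of_le_of_ne (not_lt.1 h2) hu⟩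
    · rintro ⟨h1, h2⟩
      exact ⟨h1, not_lt.2 h2.le⟩

theorem ae_uniformPoints_signPeak_pos (m : ℕ) {t : ℝ} (ht : 0 < t) :
    ∀ᵐ u ∂uniformPoints m t, 0 < signPeak (pointCount Finset.univ u) t := by
  filter_upwards [ae_uniformPoints_mem m t] with u hu
  have hx := (monotone_pointCount Finset.univ u).measurable
  have h0 : pointCount Finset.univ u 0 = 0 := by
    unfold pointCount
    rw [Finset.filter_false_of_mem fun i _ => not_le.2 (hu i).1, Finset.card_empty]
  have hp : IsFirstPassage (pointCount Finset.univ u) 0 0 := by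
    refine ⟨le_rfl, fun s hs => ?_, signIntegral_zero _, h0 ▸ Even.zero⟩
    rw [le_antisymm hs.2 hs.1, signIntegral_zero]
  obtain ⟨s, hs, hbs⟩ := hp.exists_lt hx (continuousWithinAt_pointCount _ u 0) ht
  exact (lt_signPeak_iff hx ht.le).2 ⟨s, ⟨hs.1.le, hs.2.le⟩, hbs⟩

theorem map_mul_signPeak_uniformPoints {c t : ℝ} (hc : 0 < c) (ht : 0 < t) (k : ℕ)
    (hM : AEMeasurable (fun u => signPeak (pointCount Finset.univ u) t)
      (uniformPoints (2 * k + 1) t)) :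
    (uniformPoints (2 * k + 1) t).map (fun u => c * signPeak (pointCount Finset.univ u) t) =
      (volume.restrict (Ioo 0 (c * t))).withDensity
        (fun x => ENNReal.ofReal (2 * density c t k x)) := by
  have hS : Measurable fun u : Fin (2 * k + 1) → ℝ =>
      c * signIntegral (pointCount Finset.univ u) t :=
    (measurable_signIntegral_pointCount _ measurable_pi_apply measurable_const).const_mul c
  have hcM := hM.const_mul c
  have := isProbabilityMeasure_uniformPoints (2 * k + 1) ht
  have hct : 0 < c * t := mul_pos hc ht
  set μ := (uniformPoints (2 * k + 1) t).map
    (fun u => c * signPeak (pointCount Finset.univ u) t) with hμ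
  set ν := (volume.restrict (Ioo 0 (c * t))).withDensity
    (fun x => ENNReal.ofReal (2 * density c t k x)) with hν
  have hμp : IsProbabilityMeasure μ := Measure.isProbabilityMeasure_map hcM
  have htail : ∀ a, 0 ≤ a → μ (Ioi a) = ν (Ioi a) := by
    intro a ha
    have h1 : μ (Ioi a) = 2 * (uniformPoints (2 * k + 1) t)
        ((fun u => c * signIntegral (pointCount Finset.univ u) t) ⁻¹' Ioi a) := by
      rw [hμ, Measure.map_apply_of_aemeasurable hcM measurableSet_Ioi]
      have h2 := uniformPoints_lt_signPeak ht k (div_nonneg ha hc.le)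
      simp_rw [div_lt_iff₀' hc] at h2
      exact h2
    rw [h1, ← Measure.map_apply hS measurableSet_Ioi, map_mul_signIntegral_uniformPoints hc ht k,
      hν, withDensity_apply _ measurableSet_Ioi, withDensity_apply _ measurableSet_Ioi,
      Measure.restrict_restrict measurableSet_Ioi, Measure.restrict_restrict measurableSet_Ioi,
      ← lintegral_const_mul _ (measurable_density c t k).ennreal_ofReal]
    have h3 : Ioi a ∩ Ioo (-(c * t)) (c * t) = Ioi a ∩ Ioo 0 (c * t) := by
      ext x
      simp only [mem_inter_iff, mem_Ioi, mem_Ioo]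
      constructor
      · rintro ⟨h1, h2, h3⟩
        exact ⟨h1, ha.trans_lt h1, h3⟩
      · rintro ⟨h1, h2, h3⟩
        exact ⟨h1, by linarith, h3⟩
    rw [h3]
    refine lintegral_congr fun x => ?_
    rw [ENNReal.ofReal_mul (by norm_num)]
    simp
  have hμ0 : μ (Iic 0) = 0 := by
    rw [hμ, Measure.map_apply_of_aemeasurable hcM measurableSet_Iic]
    refine measure_eq_zero_iff_ae_notMem.2 ?_
    filter_upwards [ae_uniformPoints_signPeak_pos (2 * k + 1) ht] with u hu
    exact not_le.2 (mul_pos hc hu)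
  have hν0 : ν (Iic 0) = 0 := by
    rw [hν, withDensity_apply _ measurableSet_Iic, Measure.restrict_restrict measurableSet_Iic]
    have : Iic 0 ∩ Ioo 0 (c * t) = ∅ := by
      ext x
      simp only [mem_inter_iff, mem_Iic, mem_Ioo, mem_empty_iff_false, iff_false]
      rintro ⟨h1, h2, -⟩
      exact absurd h2 (not_lt.2 h1)
    simp [this]
  have htot : ν univ = 1 := by
    rw [← measure_add_measure_compl (measurableSet_Iic (a := (0 : ℝ))), hν0, compl_Iic,
      ← htail 0 le_rfl, ← compl_Iic, prob_compl_eq_one_sub measurableSet_Iic, hμ0]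
    simp
  have hνp : IsProbabilityMeasure ν := ⟨htot⟩
  refine Measure.ext_of_Iic μ ν fun a => ?_
  rcases le_or_gt 0 a with ha | ha
  · rw [← compl_Ioi, prob_compl_eq_one_sub measurableSet_Ioi,
      prob_compl_eq_one_sub measurableSet_Ioi, htail a ha]
  · have hsub : Iic a ⊆ Iic 0 := Iic_subset_Iic.2 ha.le
    rw [measure_mono_null hsub hμ0, measure_mono_null hsub hν0]

/-- Given `V = c` and `N t = m`, the position and the maximum are jointly distributed as for `m`
uniform reversal points. -/
theorem IsSymmetricTelegraph.identDistrib_position_maximum {Ω : Type*} [MeasurableSpace Ω]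
    {P : Measure Ω} [IsProbabilityMeasure P] {rate : ℝ≥0} {c : ℝ} {V : Ω → ℝ} {N : ℝ≥0 → Ω → ℕ}
    (hT : IsSymmetricTelegraph rate c V N P) (hc : 0 < c) (hrate : 0 < rate) {t : ℝ≥0}
    (ht : 0 < t) (m : ℕ) :
    IdentDistrib (fun ω => (position V N t ω, maximum V N t ω))
      (fun u => (c * signIntegral (pointCount Finset.univ u) t,
        c * signPeak (pointCount Finset.univ u) t))
      P[|{ω | V ω = c ∧ N t ω = m}] (uniformPoints m t) := by
  have h := (hT.identDistrib_signIntegral_signPeak hrate ht m).comp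
    (u := fun p : ℝ × ℝ => (c * p.1, c * p.2)) (by fun_prop)
  have hae : (fun ω => (c * signIntegral (fun r => N r.toNNReal ω) t,
      c * signPeak (fun r => N r.toNNReal ω) t)) =ᵐ[P[|{ω | V ω = c ∧ N t ω = m}]]
      fun ω => (position V N t ω, maximum V N t ω) := by
    filter_upwards [ae_cond_mem (μ := P) (hT.measurableSet_event t m)] with ω hω
    have hV : V ω = c := hω.1
    rw [position_eq_mul_signIntegral, maximum_eq_mul_signPeak _ _ _ _ (hV ▸ hc.le), hV]
  exact ⟨h.aemeasurable_fst.congr hae, h.aemeasurable_snd,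
    (Measure.map_congr hae.symm).trans h.map_eq⟩

end Telegraph

theorem mainTheorem1 {Ω : Type*} [MeasurableSpace Ω] (P : Measure Ω) [IsProbabilityMeasure P]
    (c : ℝ) (hc : 0 < c) (rate : ℝ≥0) (hrate : 0 < rate) (V : Ω → ℝ) (N : ℝ≥0 → Ω → ℕ)
    (hT : Telegraph.IsSymmetricTelegraph rate c V N P) (t : ℝ≥0) (ht : 0 < t) (k : ℕ) :
    -- the maximum has conditional density `2 * density` on `(0, ct)`
    HasLaw (Telegraph.maximum V N t)
      ((volume.restrict (Ioo 0 (c * t))).withDensity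
        (fun β => ENNReal.ofReal (2 * Telegraph.density c t k β)))
      (P[|{ω | V ω = c ∧ N t ω = 2 * k + 1}]) ∧
    -- the position has conditional density `density` on `(-ct, ct)`
    HasLaw (Telegraph.position V N t)
      ((volume.restrict (Ioo (-(c * t)) (c * t))).withDensity
        (fun x => ENNReal.ofReal (Telegraph.density c t k x)))
      (P[|{ω | V ω = c ∧ N t ω = 2 * k + 1}]) ∧
    -- the conditional reflection principle
    ∀ β ∈ Ioo 0 (c * t),
      (P[|{ω | V ω = c ∧ N t ω = 2 * k + 1}])
          {ω | β < Telegraph.maximum V N t ω ∧ Telegraph.position V N t ω < β} =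
        (P[|{ω | V ω = c ∧ N t ω = 2 * k + 1}])
          {ω | β < Telegraph.maximum V N t ω ∧ β < Telegraph.position V N t ω} ∧
      (P[|{ω | V ω = c ∧ N t ω = 2 * k + 1}])
          {ω | β < Telegraph.maximum V N t ω ∧ β < Telegraph.position V N t ω} =
        (P[|{ω | V ω = c ∧ N t ω = 2 * k + 1}]) {ω | β < Telegraph.position V N t ω} := by
  have ht' : (0 : ℝ) < t := ht
  have h := hT.identDistrib_position_maximum hc hrate ht (2 * k + 1)
  have hpos := h.comp measurable_fst
  have hmax := h.comp measurable_snd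
  have hM : AEMeasurable (fun u => Telegraph.signPeak (Telegraph.pointCount Finset.univ u) t)
      (Telegraph.uniformPoints (2 * k + 1) t) := by
    have h1 := hmax.aemeasurable_snd.const_mul c⁻¹
    refine h1.congr (Filter.Eventually.of_forall fun u => ?_)
    exact inv_mul_cancel_left₀ hc.ne' _
  refine ⟨⟨hmax.aemeasurable_fst, hmax.map_eq.trans ?_⟩,
    ⟨hpos.aemeasurable_fst, hpos.map_eq.trans ?_⟩, fun β hβ => ?_⟩
  · exact Telegraph.map_mul_signPeak_uniformPoints hc ht' k hM
  · exact Telegraph.map_mul_signIntegral_uniformPoints hc ht' k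
  have m₁ : MeasurableSet {p : ℝ × ℝ | β < p.2 ∧ p.1 < β} :=
    (measurableSet_lt measurable_const measurable_snd).inter
      (measurableSet_lt measurable_fst measurable_const)
  have m₂ : MeasurableSet {p : ℝ × ℝ | β < p.2 ∧ β < p.1} :=
    (measurableSet_lt measurable_const measurable_snd).inter
      (measurableSet_lt measurable_const measurable_fst)
  have m₃ : MeasurableSet {p : ℝ × ℝ | β < p.1} :=
    measurableSet_lt measurable_const measurable_fst
  have e₁ := h.measure_mem_eq m₁
  have e₂ := h.measure_mem_eq m₂
  have e₃ := h.measure_mem_eq m₃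
  constructor
  · refine e₁.trans (Eq.trans ?_ e₂.symm)
    have hr := Telegraph.uniformPoints_reflection (odd_two_mul_add_one k)
      (div_nonneg hβ.1.le hc.le) ht'.le
    simp_rw [div_lt_iff₀' hc, lt_div_iff₀' hc] at hr
    exact hr
  · refine e₂.trans (Eq.trans (congrArg _ ?_) e₃.symm)
    ext u
    refine ⟨fun hu => hu.2, fun hu => ⟨lt_of_lt_of_le hu ?_, hu⟩⟩
    exact mul_le_mul_of_nonneg_left (Telegraph.signIntegral_le_signPeak
      (Telegraph.monotone_pointCount _ u).measurable (right_mem_Icc.2 ht'.le)) hc.le
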